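/- Let $(W,S)$ be a Coxeter system with $S$ finite, and let $W_0$ be a torsion-free normal subgroup of finite index of $W$ (such subgroups exist by Selberg's lemma). Let $\Sigma$ be the Coxeter complex, i.e. the Cayley graph of $(W,S)$, whose vertices are called chambers and whose edges are called panels; $W$ acts on it by left translation. A spherical residue of $\Sigma$ is a coset $wW_J$, where $J\subset S$ generates a finite subgroup $W_J$. A root is the set of chambers that are closer to $x$ than to $y$, for adjacent chambers $x,y$, and its wall is the set of panels that join it to its complement. For a $W_0$-orbit $O$ of walls let $T_O$ be the graph whose vertices are the connected components of $\Sigma$ with the panels of the walls in $O$ removed, two distinct components being joined by an edge if they contain adjacent chambers. The spherical residues of $T_O$ are its vertices and its edges, i.e. the sets $\{a\}$ and $\{a,b\}$ with $a$, $b$ adjacent vertices; roots in $T_O$ are defined as above. For $X=\Sigma$ or $X=T_O$ let $\mathcal R_{sph}(X)$ be the set of spherical residues. For $R,S\in \mathcal R_{sph}(X)$ let $\mathrm{proj}_S(R)$ be the set of the chambers (vertices of $X$) of $S$ that are nearest to $c$ in $S$ for some $c\in R$. Let $\mathcal C_{sph}(X)$ be the closure of the set of maps $S\mapsto \mathrm{proj}_S(R)$,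 $R\in\mathcal R_{sph}(X)$, in the product, over $S \in \mathcal R_{sph}(X)$, of the discrete sets of spherical residues contained in $S$. Residues $R$ are identified with the points $S\mapsto \mathrm{proj}_S(R)$ of $\mathcal C_{sph}(X)$. An element $w\in W$ induces isomorphisms $T_O\to T_{wO}$, and so acts on $\prod_O T_O$ and on $\prod_O\mathcal C_{sph}(T_O)$ by permuting the factors accordingly. Then there are finitely many $W_0$-orbits of walls, and every $T_O$ is a tree. For every $R\in\mathcal R_{sph}(\Sigma)$ and every $O$, the set $\psi_O(R)$ of components that meet $R$ is a vertex or an edge of $T_O$. There is an injective $W$-equivariant map $$\phi:\mathcal C_{sph}(\Sigma)\to\prod_{O}\mathcal C_{sph}(T_O)$$ whose restriction to $\mathcal R_{sph}(\Sigma)$ is $\psi=(\psi_O)_O$. Moreover, the image under $\phi$ of every combinatorial sector of $\Sigma$ is contained in a product $\prod_O L_O$, where each $L_O$ is the set of vertices and edges of a finite path (a segment) or of an injective infinite path (a half-line) in $T_O$. Here a sector from $x\in\mathcal R_{sph}(\Sigma)$ to $\xi\in\mathcal C_{sph}(\Sigma)$ is a set of chambers $Q(x,\xi)=\bigcup_n\bigcap_{k\ge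 n}\mathrm{Conv}(x,x_k)$, where $(x_k)$ is a sequence of spherical residues converging to $\xi$ and $\mathrm{Conv}(x,y)$ is the intersection of all roots that contain $x$ and $y$; its image is the set of all $\phi(y)$ for the spherical residues $y\subset Q(x,\xi)$, in particular for the chambers $y\in Q(x,\xi)$. The claim holds in both readings of "a root contains a residue": that it contains all chambers of the residue, or that it contains at least one. -/

import Mathlib

open Set Filter Topology

noncomputable section

/-! ### Chamber graphs, residues, projections, roots -/

/-- A set `V` of chambers with its adjacency graph and the family of its spherical residues,
each residue being recorded as a set of chambers. -/
structure ChamberGraph (V : Type*) where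
  graph : SimpleGraph V
  sph : Set (Set V)

namespace ChamberGraph

variable {V V' : Type*}

/-- The set of spherical residues. -/
def Rsph (X : ChamberGraph V) : Type _ := {R : Set V // R ∈ X.sph}

/-- The projection `proj_R(c)`: the set of chambers of `R` that are at minimal distance from `c`
(one chamber, when `R` is a residue). -/
def projChamber (X : ChamberGraph V) (R : Set V) (c : V) : Set V :=
  {d | d ∈ R ∧ ∀ e ∈ R, X.graph.dist c d ≤ X.graph.dist c e}

/-- The projection `proj_R(A)`: the union of the projections to `R` of the chambers of `A`. -/
def proj (X : ChamberGraph V) (R A : Set V) : Set V := ⋃ c ∈ A, X.projChamber R c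

/-- A root (half-apartment): the set of all chambers whose projection to the panel `{x, y}`
is `x`, where `x` and `y` are adjacent chambers. -/
def IsRoot (X : ChamberGraph V) (α : Set V) : Prop :=
  ∃ x y, X.graph.Adj x y ∧ α = {c | X.projChamber {x, y} c = {x}}

/-! ### The combinatorial bordification -/

/-- The map `S ↦ proj_S(R)`. Only the values on spherical residues `S` matter. -/
def piRes (X : ChamberGraph V) (R : X.Rsph) : X.Rsph → Set V := fun S => X.proj S.1 R.1

/-- The product topology on families indexed by the spherical residues, for the discrete topology
on each factor. (The factor of index `S` is enlarged to all sets of chambers. Since every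
factor is discrete, this does not change closures.) -/
@[reducible] def productTopology (X : ChamberGraph V) : TopologicalSpace (X.Rsph → Set V) :=
  @Pi.topologicalSpace X.Rsph (fun _ => Set V) (fun _ => ⊥)

/-- The combinatorial bordification `C_sph(X)`: the closure of the set of all maps
`S ↦ proj_S(R)`, for `R` a spherical residue, in the product topology. -/
def Csph (X : ChamberGraph V) : Type _ :=
  {ξ : X.Rsph → Set V // ξ ∈ @closure _ X.productTopology (range X.piRes)}

instance (X : ChamberGraph V) : TopologicalSpace X.Csph :=
  TopologicalSpace.induced Subtype.val X.productTopology

/-- The canonical map from spherical residues to the bordification. -/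
def ofRes (X : ChamberGraph V) (R : X.Rsph) : X.Csph :=
  ⟨X.piRes R, @subset_closure _ X.productTopology _ _ (mem_range_self R)⟩

/-! ### Isomorphisms act on the bordification -/

/-- Isomorphisms of chamber graphs that preserve spherical residues. -/
structure Iso (X : ChamberGraph V) (Y : ChamberGraph V') where
  toIso : X.graph ≃g Y.graph
  preimage_mem : ∀ S ∈ Y.sph, toIso ⁻¹' S ∈ X.sph
  image_mem : ∀ R ∈ X.sph, toIso '' R ∈ Y.sph

/-- Graph isomorphisms preserve distances. -/
theorem iso_dist {G : SimpleGraph V} {G' : SimpleGraph V'} (e : G ≃g G') (a b : V) :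
    G'.dist (e a) (e b) = G.dist a b := by
  by_cases h : G.Reachable a b
  · apply le_antisymm
    · obtain ⟨p, hp⟩ := h.exists_walk_length_eq_dist
      have := G'.dist_le (p.map e.toHom)
      rw [SimpleGraph.Walk.length_map, hp] at this
      exact this
    · have h' : G'.Reachable (e a) (e b) := SimpleGraph.Iso.reachable_iff.2 h
      obtain ⟨p, hp⟩ := h'.exists_walk_length_eq_dist
      have := G.dist_le ((p.map e.symm.toHom).copy (e.symm_apply_apply a) (e.symm_apply_apply b))
      rw [SimpleGraph.Walk.length_copy, SimpleGraph.Walk.length_map, hp] at this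
      exact this
  · have h' : ¬ G'.Reachable (e a) (e b) := fun h' => h (SimpleGraph.Iso.reachable_iff.1 h')
    rw [SimpleGraph.dist_eq_zero_of_not_reachable h, SimpleGraph.dist_eq_zero_of_not_reachable h']

theorem projChamber_image {X : ChamberGraph V} {Y : ChamberGraph V'} (e : X.graph ≃g Y.graph)
    (R : Set V) (c : V) : Y.projChamber (e '' R) (e c) = e '' X.projChamber R c := by
  ext d
  constructor
  · rintro ⟨⟨d, hd, rfl⟩, h⟩
    refine ⟨d, ⟨hd, fun f hf => ?_⟩, rfl⟩
    have := h (e f) (mem_image_of_mem e hf)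
    rwa [iso_dist, iso_dist] at this
  · rintro ⟨d, ⟨hd, h⟩, rfl⟩
    refine ⟨mem_image_of_mem e hd, ?_⟩
    rintro _ ⟨f, hf, rfl⟩
    rw [iso_dist, iso_dist]
    exact h f hf

theorem proj_image {X : ChamberGraph V} {Y : ChamberGraph V'} (e : X.graph ≃g Y.graph)
    (R A : Set V) : Y.proj (e '' R) (e '' A) = e '' X.proj R A := by
  simp only [proj, biUnion_image, image_iUnion, projChamber_image]

namespace Iso

variable {X : ChamberGraph V} {Y : ChamberGraph V'}

/-- The action of an isomorphism on families: `(e ξ)(S) = e(ξ(e⁻¹ S))`. -/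
def mapFun (e : X.Iso Y) (ξ : X.Rsph → Set V) : Y.Rsph → Set V' :=
  fun S => e.toIso '' ξ ⟨e.toIso ⁻¹' S.1, e.preimage_mem S.1 S.2⟩

theorem mapFun_piRes (e : X.Iso Y) (R : X.Rsph) :
    e.mapFun (X.piRes R) = Y.piRes ⟨e.toIso '' R.1, e.image_mem R.1 R.2⟩ := by
  funext S
  simp only [mapFun, piRes]
  rw [← proj_image, image_preimage_eq _ e.toIso.surjective]

/-- The action of an isomorphism on the bordification: `(e ξ)(S) = e(ξ(e⁻¹ S))`. -/
def map (e : X.Iso Y) (ξ : X.Csph) : Y.Csph :=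
  ⟨e.mapFun ξ.1, by
    let _ : TopologicalSpace (X.Rsph → Set V) := X.productTopology
    let _ : TopologicalSpace (Y.Rsph → Set V') := Y.productTopology
    have hc : Continuous e.mapFun := by
      let _ : TopologicalSpace (Set V) := ⊥
      let _ : TopologicalSpace (Set V') := ⊥
      have : DiscreteTopology (Set V) := ⟨rfl⟩
      refine continuous_pi fun S => ?_
      exact (continuous_of_discreteTopology (f := fun A : Set V => e.toIso '' A)).comp
        (continuous_apply (⟨e.toIso ⁻¹' S.1, e.preimage_mem S.1 S.2⟩ : X.Rsph))
    refine map_mem_closure hc ξ.2 ?_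
    rintro _ ⟨R, rfl⟩
    rw [e.mapFun_piRes]
    exact mem_range_self _⟩

end Iso

/-! ### Sectors -/

/-- The two readings of `the root α contains the residue R`: all chambers of `R` lie in `α`
(`strict = true`), or some chamber of `R` lies in `α` (`strict = false`). -/
def Contains (strict : Bool) (α R : Set V) : Prop :=
  if strict then R ⊆ α else (R ∩ α).Nonempty

/-- The combinatorial convex closure `Conv(x, y)`: the intersection of all roots that contain
`x` and `y`, as a set of chambers. -/
def conv (X : ChamberGraph V) (strict : Bool) (x y : Set V) : Set V :=
  ⋂₀ {α | X.IsRoot α ∧ Contains strict α x ∧ Contains strict α y}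

/-- `Q` is a combinatorial sector from `x` to `ξ`: it is `⋃ n, ⋂ k ≥ n, Conv(x, u k)` for a
sequence `u` of spherical residues converging to `ξ`. -/
def IsSector (X : ChamberGraph V) (strict : Bool) (x : X.Rsph) (ξ : X.Csph) (Q : Set V) : Prop :=
  ∃ u : ℕ → X.Rsph, Tendsto (fun k => X.ofRes (u k)) atTop (𝓝 ξ) ∧
    Q = ⋃ n, ⋂ k, ⋂ (_ : n ≤ k), X.conv strict x.1 (u k).1

/-! ### Graphs whose spherical residues are the vertices and the edges -/

/-- The chamber graph of a tree `T`: the chambers are the vertices, and the spherical residues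
are the vertices and the edges (as for the Coxeter complex of a free product of groups of
order two). -/
def ofTree (T : SimpleGraph V) : ChamberGraph V where
  graph := T
  sph := {R | (∃ a, R = {a}) ∨ ∃ a b, T.Adj a b ∧ R = {a, b}}

/-- The isomorphism of chamber graphs given by an isomorphism of trees. -/
def isoOfTree {T : SimpleGraph V} {T' : SimpleGraph V'} (e : T ≃g T') :
    (ofTree T).Iso (ofTree T') where
  toIso := e
  preimage_mem := by
    rintro S (⟨a, rfl⟩ | ⟨a, b, hab, rfl⟩)
    · obtain ⟨a, rfl⟩ := e.surjective a
      refine Or.inl ⟨a, ?_⟩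
      ext c
      exact e.injective.eq_iff
    · obtain ⟨a, rfl⟩ := e.surjective a
      obtain ⟨b, rfl⟩ := e.surjective b
      refine Or.inr ⟨a, b, e.map_adj_iff.1 hab, ?_⟩
      ext c
      exact or_congr e.injective.eq_iff e.injective.eq_iff
  image_mem := by
    rintro S (⟨a, rfl⟩ | ⟨a, b, hab, rfl⟩)
    · exact Or.inl ⟨e a, image_singleton⟩
    · exact Or.inr ⟨e a, e b, e.map_adj_iff.2 hab, image_pair _ _ _⟩

/-- A segment in `T`, as a set of vertices and edges: those of a finite path. -/
def IsSegment (T : SimpleGraph V) (L : Set (ofTree T).Rsph) : Prop :=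
  ∃ (a b : V) (p : T.Walk a b), p.IsPath ∧
    L = {R | (∃ c ∈ p.support, R.1 = {c}) ∨ ∃ c d, s(c, d) ∈ p.edges ∧ R.1 = {c, d}}

/-- A half-line in `T`, as a set of vertices and edges: those of an injective infinite path. -/
def IsHalfLine (T : SimpleGraph V) (L : Set (ofTree T).Rsph) : Prop :=
  ∃ f : ℕ → V, Function.Injective f ∧ (∀ n, T.Adj (f n) (f (n + 1))) ∧
    L = {R | (∃ n, R.1 = {f n}) ∨ ∃ n, R.1 = {f n, f (n + 1)}}

end ChamberGraph

/-! ### The Coxeter complex, its walls, and the trees -/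

namespace CoxeterTrees

open ChamberGraph

variable {B W : Type*} [Group W] {M : CoxeterMatrix B} (cs : CoxeterSystem M W)

/-- The Coxeter complex: the Cayley graph of `W`, whose spherical residues are the left cosets
`w W_J` for those `J ⊆ S` that generate a finite subgroup `W_J`. -/
def complex : ChamberGraph W where
  graph := SimpleGraph.mulCayley (range cs.simple)
  sph := {R | ∃ (w : W) (J : Set B), (Subgroup.closure (cs.simple '' J) : Set W).Finite ∧
    R = (w * ·) '' (Subgroup.closure (cs.simple '' J) : Set W)}

/-- Left translation by `g`, as a graph automorphism. -/
def graphTranslation (g : W) : (complex cs).graph ≃g (complex cs).graph where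
  toEquiv := Equiv.mulLeft g
  map_rel_iff' := SimpleGraph.mulCayley_adj_mul_iff_right

/-- Left translation by `g`, as an automorphism of the Coxeter complex. -/
def translation (g : W) : (complex cs).Iso (complex cs) where
  toIso := graphTranslation cs g
  preimage_mem := by
    rintro _ ⟨w, J, hJ, rfl⟩
    refine ⟨g⁻¹ * w, J, hJ, ?_⟩
    ext c
    change (∃ u, _ ∧ w * u = g * c) ↔ (∃ u, _ ∧ g⁻¹ * w * u = c)
    simp only [mul_assoc, inv_mul_eq_iff_eq_mul]
  image_mem := by
    rintro _ ⟨w, J, hJ, rfl⟩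
    refine ⟨g * w, J, hJ, ?_⟩
    rw [image_image]
    change (fun u => g * (w * u)) '' _ = _
    simp only [mul_assoc]

/-- The wall of a root `α`: the set of panels (edges) that join a chamber of `α` to
a chamber of the opposite root, which is the complement of `α`. -/
def wall (α : Set W) : Set (Sym2 W) :=
  {e | ∃ x y, e = s(x, y) ∧ (complex cs).graph.Adj x y ∧ x ∈ α ∧ y ∉ α}

/-- A wall is the wall of some root. -/
def IsWall (H : Set (Sym2 W)) : Prop := ∃ α, (complex cs).IsRoot α ∧ H = wall cs α

/-- The translate `g H` of a set of panels. -/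
def moveWall (g : W) (H : Set (Sym2 W)) : Set (Sym2 W) := Sym2.map (g * ·) '' H

/-- The orbit of a wall under the subgroup `W₀`. -/
def wallOrbit (W₀ : Subgroup W) (H : Set (Sym2 W)) : Set (Set (Sym2 W)) :=
  {H' | ∃ g ∈ W₀, H' = moveWall g H}

/-- The set of `W₀`-orbits of walls. -/
def WallOrbits (W₀ : Subgroup W) : Type _ :=
  {O : Set (Set (Sym2 W)) // ∃ H, IsWall cs H ∧ O = wallOrbit W₀ H}

/-- The graph of chambers without the panels that lie on a wall of `O`. -/
def cutGraph (O : Set (Set (Sym2 W))) : SimpleGraph W := (complex cs).graph.deleteEdges (⋃₀ O)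

/-- The graph `T_{W₀}(H)`, for `O` the `W₀`-orbit of `H`: its vertices are the connected
components of the complement of the walls of `O`, and two distinct components are
joined by an edge if they have adjacent chambers. -/
def wallTree (O : Set (Set (Sym2 W))) : SimpleGraph (cutGraph cs O).ConnectedComponent where
  Adj C D := C ≠ D ∧ ∃ a b, (cutGraph cs O).connectedComponentMk a = C ∧
    (cutGraph cs O).connectedComponentMk b = D ∧ (complex cs).graph.Adj a b
  symm := ⟨fun _ _ ⟨h, a, b, ha, hb, hab⟩ => ⟨h.symm, b, a, hb, ha, hab.symm⟩⟩
  loopless := ⟨fun _ h => h.1 rfl⟩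

/-- The image of a residue `R` in the tree of `O`: the set of the components that meet `R`.
It is the vertex containing `R` if no wall of `O` crosses `R`, and otherwise the edge
given by the wall of `O` that crosses `R`. -/
def psi (O : Set (Set (Sym2 W))) (R : Set W) : Set (cutGraph cs O).ConnectedComponent :=
  (cutGraph cs O).connectedComponentMk '' R

/-! ### The action of `W` on the trees -/

theorem moveWall_mul (g h : W) (H : Set (Sym2 W)) :
    moveWall (g * h) H = moveWall g (moveWall h H) := by
  simp only [moveWall, image_image, Sym2.map_map]
  congr! 3
  funext x
  exact mul_assoc g h x

theorem IsWall.move {H : Set (Sym2 W)} (hH : IsWall cs H) (g : W) :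
    IsWall cs (moveWall g H) := by
  obtain ⟨α, ⟨x, y, hxy, hα⟩, rfl⟩ := hH
  have hadj : ∀ a b, (complex cs).graph.Adj (g * a) (g * b) ↔ (complex cs).graph.Adj a b :=
    fun a b => (graphTranslation cs g).map_adj_iff
  refine ⟨(g * ·) '' α, ⟨g * x, g * y, (hadj x y).2 hxy, ?_⟩, ?_⟩
  · ext c
    obtain ⟨c, rfl⟩ := (graphTranslation cs g).surjective c
    have h1 : ({g * x, g * y} : Set W) = graphTranslation cs g '' {x, y} :=
      (image_pair _ _ _).symm
    have h2 : ({g * x} : Set W) = graphTranslation cs g '' {x} := image_singleton.symm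
    change _ ∈ (graphTranslation cs g) '' α ↔ _ = _
    rw [(graphTranslation cs g).injective.mem_set_image, h1, h2, projChamber_image,
      (graphTranslation cs g).injective.image_injective.eq_iff, hα]
    rfl
  · ext e
    constructor
    · rintro ⟨_, ⟨a, b, rfl, hab, ha, hb⟩, rfl⟩
      refine ⟨g * a, g * b, rfl, (hadj a b).2 hab, ⟨a, ha, rfl⟩, ?_⟩
      rintro ⟨b', hb', h⟩
      exact hb (mul_left_cancel h ▸ hb')
    · rintro ⟨_, b, rfl, hab, ⟨a, ha, rfl⟩, hb⟩
      refine ⟨s(a, g⁻¹ * b), ⟨a, g⁻¹ * b, rfl, ?_, ha, fun h => hb ⟨_, h, by simp⟩⟩, by simp⟩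
      rw [← hadj]
      simpa using hab

theorem image_wallOrbit (W₀ : Subgroup W) [W₀.Normal] (g : W) (H : Set (Sym2 W)) :
    moveWall g '' wallOrbit W₀ H = wallOrbit W₀ (moveWall g H) := by
  ext K
  constructor
  · rintro ⟨_, ⟨w, hw, rfl⟩, rfl⟩
    refine ⟨g * w * g⁻¹, Subgroup.Normal.conj_mem inferInstance w hw g, ?_⟩
    rw [← moveWall_mul, ← moveWall_mul]
    simp
  · rintro ⟨w, hw, rfl⟩
    refine ⟨_, ⟨g⁻¹ * w * g, ?_, rfl⟩, ?_⟩
    · simpa using Subgroup.Normal.conj_mem inferInstance w hw g⁻¹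
    · rw [← moveWall_mul, ← moveWall_mul]
      simp [mul_assoc]

/-- The action of `W` on the set of `W₀`-orbits of walls. -/
def WallOrbits.move {W₀ : Subgroup W} [W₀.Normal] (g : W) (O : WallOrbits cs W₀) :
    WallOrbits cs W₀ :=
  ⟨moveWall g '' O.1, by
    obtain ⟨H, hH, hO⟩ := O.2
    exact ⟨moveWall g H, hH.move cs g, by rw [hO, image_wallOrbit]⟩⟩

theorem mem_moved (g : W) (O : Set (Set (Sym2 W))) (a b : W) :
    s(g * a, g * b) ∈ ⋃₀ (moveWall g '' O) ↔ s(a, b) ∈ ⋃₀ O := by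
  have hinj : Function.Injective (Sym2.map (g * ·) : Sym2 W → Sym2 W) :=
    Sym2.map.injective (mul_right_injective g)
  constructor
  · rintro ⟨_, ⟨H, hH, rfl⟩, e, he, h⟩
    have : e = s(a, b) := hinj h
    exact ⟨H, hH, this ▸ he⟩
  · rintro ⟨H, hH, h⟩
    exact ⟨_, ⟨H, hH, rfl⟩, s(a, b), h, rfl⟩

/-- Left translation by `g` maps the complement of the walls of `O` to that of `g O`. -/
def cutIso (g : W) (O : Set (Set (Sym2 W))) :
    cutGraph cs O ≃g cutGraph cs (moveWall g '' O) where
  toEquiv := Equiv.mulLeft g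
  map_rel_iff' := by
    intro a b
    simp only [cutGraph, SimpleGraph.deleteEdges_adj, Equiv.coe_mulLeft, mem_moved]
    exact and_congr_left' (graphTranslation cs g).map_adj_iff

/-- The isomorphism from the tree of `O` to the tree of `g O` that is induced by `g`: it sends
the component of a chamber `a` to the component of `g a`. -/
def treeIso (g : W) (O : Set (Set (Sym2 W))) :
    wallTree cs O ≃g wallTree cs (moveWall g '' O) where
  toEquiv := (cutIso cs g O).connectedComponentEquiv
  map_rel_iff' := by
    intro C D
    refine and_congr (not_congr (Equiv.apply_eq_iff_eq _)) ⟨?_, ?_⟩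
    · rintro ⟨a, b, ha, hb, hab⟩
      refine ⟨(cutIso cs g O).symm a, (cutIso cs g O).symm b, ?_, ?_, ?_⟩
      · exact SimpleGraph.ConnectedComponent.iso_inv_image_comp_eq_iff_eq_map.2 ha
      · exact SimpleGraph.ConnectedComponent.iso_inv_image_comp_eq_iff_eq_map.2 hb
      · exact (graphTranslation cs g).symm.map_adj_iff.2 hab
    · rintro ⟨a, b, rfl, rfl, hab⟩
      exact ⟨g * a, g * b, rfl, rfl, (graphTranslation cs g).map_adj_iff.2 hab⟩

/-- The chamber graph of the tree attached to an orbit of walls. -/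
abbrev treeComplex {W₀ : Subgroup W} (O : WallOrbits cs W₀) :
    ChamberGraph (cutGraph cs O.1).ConnectedComponent :=
  ofTree (wallTree cs O.1)

end CoxeterTrees

end

/-! Attach to every reflection `t` a function `side cs t : W → ZMod 2` telling on which side of its
wall a chamber lies. Crossing a panel `{a, b}` changes the side for the single reflection `b * a⁻¹`,
and `t` swaps its own two sides. Distances, roots and projections are all read off from these two
facts.

Two reflections `t`, `t'` with walls in one `W₀`-orbit satisfy `t * t' ∈ W₀`. If their walls cross,
or if both walls cross one spherical residue, then `t * t'` has finite order (`Cross.isOfFinOrder`,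
`isOfFinOrder_mul_of_crosses`), so `t = t'` by torsion-freeness. Hence the walls of an orbit `O` are
nested: each gives a single edge of the tree graph, this edge is a bridge, and a spherical residue
is crossed by at most one wall of `O`.

The projection of a residue to `S` is determined wall by wall (`mem_proj_iff`), so a point of the
bordification is determined by its values on panels (`Csph_ext`). The map to the tree commutes with
projections to chambers and panels (`IsNested.psi_proj`), and every vertex or edge is the image of a
chamber or panel. Evaluating on such a representative defines `phi`; it is injective because the
tree of the wall of a panel separates the two chambers of that panel.

Half-trees pull back to roots, so `conv` maps into the hull of two vertices or edges, which lies on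
a geodesic. Infinitely many of the geodesics coming from a sector start at the same vertex, so the
image of the sector is a chain for betweenness from that vertex: it lies on a segment or a
half-line. -/

namespace CoxeterTrees

open ChamberGraph

noncomputable section

variable {B W : Type*} [Group W] {M : CoxeterMatrix B} (cs : CoxeterSystem M W)

/-! ### The sign cocycle and the sides of a wall -/

open Classical in
/-- The action of a generator `s` on pairs consisting of a group element and a sign: it conjugates
the first entry by `s`, and changes the sign exactly when the first entry is `s`. -/
def signStep (s : W) : Function.End (W × ZMod 2) :=
  fun p => (s * p.1 * s, p.2 + if p.1 = s then 1 else 0)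

/-- Since `s` inverts `r`, moving `r ^ k` past `s` doubles the exponent. This locates the sign
changes in the next lemma. -/
theorem conj_eq_iff_of_inverts {s r t : W} (h : s * r * s⁻¹ = r⁻¹) (k : ℕ) (j : ℕ) :
    r ^ k * t * (r ^ k)⁻¹ = s * r ^ j ↔ t = s * r ^ (2 * k + j) := by
  have hk : s * r ^ k * s⁻¹ = (r ^ k)⁻¹ := by
    rw [← conj_pow, h, inv_pow]
  have hk' : (r ^ k)⁻¹ * s = s * r ^ k := by rw [← hk]; group
  rw [mul_inv_eq_iff_eq_mul, ← eq_inv_mul_iff_mul_eq, ← mul_assoc, ← mul_assoc, hk']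
  rw [show 2 * k + j = k + j + k by ring, pow_add, pow_add]
  simp only [mul_assoc]

-- In the step from `k` to `k + 1`, `s'` contributes the term `n = 2 * k` and `s` the term `n = 2 *
-- k + 1`.
open Classical in
theorem signStep_mul_pow {s s' : W} (hs : s * s = 1) (hs' : s' * s' = 1) (k : ℕ) (t : W)
    (ε : ZMod 2) :
    ((signStep s * signStep s') ^ k) (t, ε) = ((s * s') ^ k * t * ((s * s') ^ k)⁻¹,
      ε + ∑ n ∈ Finset.range (2 * k), if t = s' * (s * s') ^ n then 1 else 0) := by
  have hsi : s⁻¹ = s := inv_eq_of_mul_eq_one_left hs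
  have hsi' : s'⁻¹ = s' := inv_eq_of_mul_eq_one_left hs'
  have hinv : s' * (s * s') * s'⁻¹ = (s * s')⁻¹ := by simp [hsi, hsi', hs', mul_assoc]
  induction k with
  | zero =>
    simp only [pow_zero, mul_zero, Finset.range_zero, Finset.sum_empty, add_zero, inv_one, one_mul,
      mul_one]
    rfl
  | succ k ih =>
    rw [pow_succ']
    change signStep s (signStep s' (((signStep s * signStep s') ^ k) (t, ε))) = _
    rw [ih]
    simp only [signStep]
    rw [show 2 * (k + 1) = 2 * k + 1 + 1 by ring, Finset.sum_range_succ, Finset.sum_range_succ]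
    have h0 := conj_eq_iff_of_inverts (t := t) hinv k 0
    have h1 := conj_eq_iff_of_inverts (t := t) hinv k 1
    have h2 : s' * ((s * s') ^ k * t * ((s * s') ^ k)⁻¹) * s' = s ↔
        (s * s') ^ k * t * ((s * s') ^ k)⁻¹ = s' * (s * s') ^ 1 := by
      rw [← eq_mul_inv_iff_mul_eq, ← eq_inv_mul_iff_mul_eq, hsi', pow_one]
    simp only [pow_zero, mul_one, add_zero] at h0
    rw [Prod.mk.injEq]
    constructor
    · rw [pow_succ' (s * s') k, mul_inv_rev, mul_inv_rev, hsi, hsi']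
      simp only [mul_assoc]
    · simp only [h2, h0, h1]
      ring

/-- The terms `n` and `m + n` agree and cancel mod 2; hence the signs respect the Coxeter relations.
-/
theorem sum_range_two_mul_eq_zero {r : W} {m : ℕ} (hr : r ^ m = 1) (f : W → ZMod 2) :
    ∑ n ∈ Finset.range (2 * m), f (r ^ n) = 0 := by
  rw [two_mul, Finset.sum_range_add]
  simp only [pow_add, hr, one_mul, CharTwo.add_self_eq_zero]

open Classical in
theorem isLiftable_signStep : M.IsLiftable fun i => signStep (cs.simple i) := by
  intro i j
  suffices h : ∀ m, (cs.simple i * cs.simple j) ^ m = 1 →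
      (signStep (cs.simple i) * signStep (cs.simple j)) ^ m = 1 from
    h _ (cs.simple_mul_simple_pow i j)
  intro m hm
  funext ⟨t, ε⟩
  refine (signStep_mul_pow (cs.simple_mul_simple_self i) (cs.simple_mul_simple_self j) m t ε).trans
    (Prod.ext ?_ ?_)
  · change _ = t
    simp [hm]
  · change _ = ε
    rw [sum_range_two_mul_eq_zero hm fun x => if t = cs.simple j * x then 1 else 0, add_zero]

/-- The action of `W` on signed group elements. -/
def signAction : W →* Function.End (W × ZMod 2) := cs.lift ⟨_, isLiftable_signStep cs⟩

/-- The sign change of `t` under `w`. -/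
def signCocycle (w t : W) : ZMod 2 := (signAction cs w (t, 0)).2

open Classical in
theorem signAction_simple (i : B) (t : W) (ε : ZMod 2) :
    signAction cs (cs.simple i) (t, ε) =
      (cs.simple i * t * cs.simple i, ε + if t = cs.simple i then 1 else 0) := by
  rw [signAction, cs.lift_apply_simple]
  rfl

theorem signAction_apply (w t : W) (ε : ZMod 2) :
    signAction cs w (t, ε) = (w * t * w⁻¹, ε + signCocycle cs w t) := by
  rw [signCocycle]
  induction w using cs.simple_induction_left generalizing ε with
  | one =>
    rw [map_one]
    change (t, ε) = (1 * t * 1⁻¹, ε + 0)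
    simp
  | mul_simple_left w i ih =>
    rw [map_mul]
    change signAction cs (cs.simple i) (signAction cs w (t, ε)) =
      (_, ε + (signAction cs (cs.simple i) (signAction cs w (t, 0))).2)
    rw [ih ε, ih 0, signAction_simple, signAction_simple]
    simp only [mul_inv_rev, cs.inv_simple, mul_assoc, zero_add, add_assoc]

theorem signCocycle_mul (v w t : W) :
    signCocycle cs (v * w) t = signCocycle cs w t + signCocycle cs v (w * t * w⁻¹) := by
  rw [signCocycle, map_mul]
  change (signAction cs v (signAction cs w (t, 0))).2 = _
  rw [signAction_apply, signAction_apply, zero_add]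

open Classical in
theorem signCocycle_simple (i : B) (t : W) :
    signCocycle cs (cs.simple i) t = if t = cs.simple i then 1 else 0 := by
  rw [signCocycle, signAction_simple, zero_add]

/-- The side of the chamber `a` with respect to the wall of the reflection `t`. -/
def side (t a : W) : ZMod 2 := signCocycle cs a⁻¹ t

/-- The first summand on the right does not depend on `a`: translation by `g` carries the sides of
`t` to those of its conjugate, up to exchanging labels. -/
theorem side_conj (g t a : W) :
    side cs (g * t * g⁻¹) (g * a) = side cs (g * t * g⁻¹) g + side cs t a := by
  rw [side, mul_inv_rev, signCocycle_mul, side, side]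
  simp [mul_assoc]

theorem side_conj_eq_iff (g t a b : W) :
    side cs (g * t * g⁻¹) (g * a) = side cs (g * t * g⁻¹) (g * b) ↔ side cs t a = side cs t b := by
  rw [side_conj, side_conj cs g t b, add_right_inj]

open Classical in
theorem side_mul_simple (t a : W) (i : B) :
    side cs t (a * cs.simple i) = side cs t a + if t = a * cs.simple i * a⁻¹ then 1 else 0 := by
  rw [side, mul_inv_rev, cs.inv_simple, signCocycle_mul, signCocycle_simple, side]
  congr 2
  rw [eq_mul_inv_iff_mul_eq, ← inv_mul_eq_iff_eq_mul, mul_assoc, inv_inv]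

/-- By `side_conj`, multiplying by `t` adds the constant `side cs t t`. It is computed at the
chamber `x`, where `t * x = x * cs.simple i` is the neighbour across the wall. -/
theorem side_reflection_mul {t : W} (ht : cs.IsReflection t) (a : W) :
    side cs t (t * a) = side cs t a + 1 := by
  obtain ⟨x, i, rfl⟩ := ht
  set t := x * cs.simple i * x⁻¹ with htdef
  have hxt : t * x = x * cs.simple i := by simp [htdef]
  have htt : t * t * t⁻¹ = t := by simp
  have h1 := side_conj cs t t a
  have h2 := side_conj cs t t x
  rw [htt] at h1 h2
  have h3 := side_mul_simple cs t x i
  rw [if_pos htdef, ← hxt] at h3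
  have h4 : side cs t t = 1 := by
    have : side cs t t + side cs t x = side cs t x + 1 := by rw [← h2, h3]
    rw [add_comm] at this
    exact add_left_cancel this
  rw [h1, h4, add_comm]

/-! ### Adjacency, distances, and separation -/

theorem adj_iff (a b : W) : (complex cs).graph.Adj a b ↔ ∃ i, b = a * cs.simple i := by
  change (SimpleGraph.mulCayley (range cs.simple)).Adj a b ↔ _
  rw [SimpleGraph.mulCayley_adj']
  constructor
  · rintro ⟨-, _, ⟨i, rfl⟩, h | h⟩
    · exact ⟨i, h.symm⟩
    · exact ⟨i, by rw [h, mul_assoc, cs.simple_mul_simple_self, mul_one]⟩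
  · rintro ⟨i, rfl⟩
    refine ⟨fun h => ?_, _, ⟨i, rfl⟩, Or.inl rfl⟩
    have h1 : cs.simple i = 1 := by simpa using h.symm
    have := cs.length_simple i
    rw [h1, cs.length_one] at this
    exact absurd this (by norm_num)

theorem isReflection_of_adj {a b : W} (h : (complex cs).graph.Adj a b) :
    cs.IsReflection (b * a⁻¹) := by
  obtain ⟨i, rfl⟩ := (adj_iff cs a b).1 h
  exact ⟨a, i, rfl⟩

theorem adj_reflection_symm {a b : W} (h : (complex cs).graph.Adj a b) : a * b⁻¹ = b * a⁻¹ := by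
  rw [← (isReflection_of_adj cs h).inv, mul_inv_rev, inv_inv]

theorem adj_mul_left {g a b : W} :
    (complex cs).graph.Adj (g * a) (g * b) ↔ (complex cs).graph.Adj a b :=
  (graphTranslation cs g).map_adj_iff

theorem side_ne_iff_of_adj {a b : W} (h : (complex cs).graph.Adj a b) (t : W) :
    side cs t a ≠ side cs t b ↔ t = b * a⁻¹ := by
  obtain ⟨i, rfl⟩ := (adj_iff cs a b).1 h
  rw [side_mul_simple]
  split_ifs with h <;> simp [h]

theorem exists_adj_of_isReflection {t : W} (ht : cs.IsReflection t) :
    ∃ x y, (complex cs).graph.Adj x y ∧ y * x⁻¹ = t := by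
  obtain ⟨x, i, rfl⟩ := ht
  exact ⟨x, x * cs.simple i, (adj_iff cs _ _).2 ⟨i, rfl⟩, rfl⟩

theorem complex_connected : (complex cs).graph.Connected := by
  have h1 : ∀ w, (complex cs).graph.Reachable 1 w := by
    intro w
    induction w using cs.simple_induction_right with
    | one => rfl
    | mul_simple_right w i ih =>
      exact ih.trans ((adj_iff cs _ _).2 ⟨i, rfl⟩ : (complex cs).graph.Adj _ _).reachable
  exact { preconnected := fun a b => (h1 a).symm.trans (h1 b), nonempty := ⟨1⟩ }

theorem finite_separating (a b : W) : {t | side cs t a ≠ side cs t b}.Finite := by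
  obtain ⟨p⟩ := (complex_connected cs).preconnected a b
  induction p with
  | nil => simp
  | @cons a b c h p ih =>
    refine (ih.insert (b * a⁻¹)).subset fun t ht => ?_
    by_cases hab : side cs t a = side cs t b
    · exact Or.inr fun h' => ht (hab.trans h')
    · exact Or.inl ((side_ne_iff_of_adj cs h t).1 hab)

/-- Reflecting the part of the walk beyond its first crossing of the wall folds the crossing step
away. -/
theorem exists_crossing {t a b : W} (p : (complex cs).graph.Walk a b)
    (h : side cs t a ≠ side cs t b) :
    (complex cs).graph.dist a (t * b) < p.length := by
  induction p with
  | nil => exact absurd rfl h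
  | @cons a c b hac p ih =>
    rw [SimpleGraph.Walk.length_cons]
    by_cases hs : side cs t a = side cs t c
    · have h1 := ih (hs ▸ h)
      have h2 := (complex_connected cs).dist_triangle (u := a) (v := c) (w := t * b)
      rw [SimpleGraph.dist_eq_one_iff_adj.2 hac] at h2
      omega
    · have h1 := (side_ne_iff_of_adj cs hac t).1 hs
      have h2 : a = t * c := by
        rw [← adj_reflection_symm cs hac] at h1
        simp [h1]
      have h3 : (complex cs).graph.dist a (t * b) = (complex cs).graph.dist c b := by
        rw [h2]
        exact iso_dist (graphTranslation cs t) c b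
      rw [h3]
      exact Nat.lt_succ_of_le ((complex cs).graph.dist_le p)

theorem dist_reflection_lt {t a b : W} (h : side cs t a ≠ side cs t b) :
    (complex cs).graph.dist a (t * b) < (complex cs).graph.dist a b := by
  obtain ⟨p, hp⟩ := (complex_connected cs).exists_walk_length_eq_dist a b
  exact hp ▸ exists_crossing cs p h

theorem dist_lt_reflection {t a b : W} (ht : cs.IsReflection t) (h : side cs t a = side cs t b) :
    (complex cs).graph.dist a b < (complex cs).graph.dist a (t * b) := by
  have h1 : side cs t a ≠ side cs t (t * b) := by
    rw [side_reflection_mul cs ht, h]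
    simp
  have h2 := dist_reflection_lt cs h1
  rwa [← mul_assoc, ht.mul_self, one_mul] at h2

/-- A chamber `a ≠ b` has a neighbour that is separated from `a` by a wall that also separates
`a` from `b`, and that is closer to `b`. -/
theorem exists_adj_separating {a b : W} (h : a ≠ b) :
    ∃ c, (complex cs).graph.Adj a c ∧ side cs (c * a⁻¹) a ≠ side cs (c * a⁻¹) b ∧
      (complex cs).graph.dist c b < (complex cs).graph.dist a b := by
  obtain ⟨p, hp⟩ := (complex_connected cs).exists_walk_length_eq_dist a b
  cases p with
  | nil => exact absurd rfl h
  | @cons _ c _ hac p =>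
    have hlt : (complex cs).graph.dist c b < (complex cs).graph.dist a b := by
      rw [← hp, SimpleGraph.Walk.length_cons]
      exact Nat.lt_succ_of_le ((complex cs).graph.dist_le p)
    refine ⟨c, hac, fun hs => ?_, hlt⟩
    have := dist_lt_reflection cs (isReflection_of_adj cs hac) hs.symm
    rw [inv_mul_cancel_right, SimpleGraph.dist_comm, SimpleGraph.dist_comm (u := b)] at this
    exact lt_asymm this hlt

theorem eq_of_forall_side_eq {a b : W}
    (h : ∀ t, cs.IsReflection t → side cs t a = side cs t b) : a = b := by
  by_contra hab
  obtain ⟨c, hac, hs, -⟩ := exists_adj_separating cs hab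
  exact hs (h _ (isReflection_of_adj cs hac))

end
end CoxeterTrees

namespace CoxeterTrees

open ChamberGraph

noncomputable section

/-! ### Sign sequences -/

/-- The sequence `σ` is antisymmetric about `m`, except at `m`. -/
def IsMirror (σ : ℤ → ZMod 2) (m : ℤ) : Prop := ∀ k, k ≠ m → σ (2 * m - k) = σ k + 1

/-- The sequence `σ` is eventually `0`, and `1` near `-∞`. -/
def IsDescending (σ : ℤ → ZMod 2) : Prop := ∃ N, ∀ n, N ≤ n → σ n = 0 ∧ σ (-n) = 1

theorem IsDescending.not_periodic {σ : ℤ → ZMod 2} (h : IsDescending σ) {q : ℤ} (hq : 0 < q)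
    (r : ℤ) (hper : ∀ i : ℤ, σ (r + q * (i + 1)) = σ (r + q * i)) : False := by
  obtain ⟨N, hN⟩ := h
  have hconst : ∀ i : ℤ, σ (r + q * i) = σ r := by
    intro i
    induction i using Int.induction_on with
    | zero => simp
    | succ i ih => rw [hper, ih]
    | pred i ih =>
      rw [← ih, ← hper (-(i : ℤ) - 1)]
      congr 2
      ring
  have h1 := (hN (r + q * (|N| + |r|)) (by
    nlinarith [le_abs_self N, neg_abs_le r, abs_nonneg N, abs_nonneg r])).1
  have h2 := (hN (-(r + q * (-(|N| + |r|)))) (by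
    nlinarith [le_abs_self N, le_abs_self r, abs_nonneg N, abs_nonneg r])).2
  rw [neg_neg, hconst] at h2
  rw [hconst, h2] at h1
  exact one_ne_zero h1

theorem IsMirror.shift {σ : ℤ → ZMod 2} {m n : ℤ} (hm : IsMirror σ m) (hn : IsMirror σ n) {k : ℤ}
    (h1 : k ≠ m) (h2 : k ≠ 2 * m - n) : σ (k + 2 * (n - m)) = σ k := by
  have h3 := hn (2 * m - k) (by omega)
  rw [hm k h1, add_assoc, CharTwo.add_self_eq_zero, add_zero] at h3
  rw [← h3]
  congr 1
  ring

/-- A descending sequence with two mirrors is a step function. -/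
theorem IsDescending.eq_one_of_isMirror {σ : ℤ → ZMod 2} (h : IsDescending σ) {m n : ℤ}
    (hmn : m < n) (hm : IsMirror σ m) (hn : IsMirror σ n) {k l : ℤ} (hkl : k ≤ l) (hl : σ l = 1) :
    σ k = 1 := by
  -- If `n - m > 1`, the progression `m + 1 + 2 * (n - m) * i` avoids the positions `m` and `2 * m -
  -- n`, the only ones where the shift by `2 * (n - m)` may fail.
  have hδ : n = m + 1 := by
    by_contra hne
    refine h.not_periodic (q := 2 * (n - m)) (by omega) (m + 1) fun i => ?_
    rw [show m + 1 + 2 * (n - m) * (i + 1) = m + 1 + 2 * (n - m) * i + 2 * (n - m) by ring]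
    refine hm.shift hn ?_ ?_
    · intro h0
      have : (n - m) * (2 * i) = -1 := by linarith
      have := Int.isUnit_iff.1 (IsUnit.of_mul_eq_one (-(2 * i)) (by linarith :
        (n - m) * -(2 * i) = 1))
      omega
    · intro h0
      have : (n - m) * (-(2 * i + 1)) = 1 := by linarith
      have := Int.isUnit_iff.1 (IsUnit.of_mul_eq_one _ this)
      omega
  subst hδ
  have hs : ∀ k, k ≠ m → k ≠ m - 1 → σ (k + 2) = σ k := by
    intro k h1 h2
    have := hm.shift hn h1 (by omega)
    rwa [show k + 2 * (m + 1 - m) = k + 2 by ring] at this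
  obtain ⟨N, hN⟩ := h
  -- The sequence has period 2 separately on `k > m` and on `k ≤ m`, so its behaviour at the two
  -- ends fixes it.
  have hup : ∀ j : ℕ, ∀ k, m < k → σ (k + 2 * j) = σ k := by
    intro j
    induction j with
    | zero => simp
    | succ j ih =>
      intro k hk
      rw [← ih k hk, ← hs (k + 2 * j) (by omega) (by omega)]
      congr 1
      push_cast
      ring
  have hdown : ∀ j : ℕ, ∀ k, k ≤ m → σ (k - 2 * j) = σ k := by
    intro j
    induction j with
    | zero => simp
    | succ j ih =>
      intro k hk
      rw [← ih k hk, ← hs (k - 2 * (j + 1 : ℕ)) (by push_cast; omega) (by push_cast; omega)]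
      congr 1
      push_cast
      ring
  have hlm : l ≤ m := by
    by_contra hlm
    rw [← hup (N - l).toNat l (by omega), (hN _ (by omega)).1] at hl
    exact zero_ne_one hl
  rw [← hdown (N + k).toNat k (by omega)]
  have := (hN (-(k - 2 * ((N + k).toNat : ℤ))) (by omega)).2
  rwa [neg_neg] at this

variable {X : Type*}

/-- Two sign sequences differ by a reflection at one position. -/
def IsFlip (σ σ' : ℤ → ZMod 2) (m : ℤ) : Prop :=
  (∀ n, n ≠ m → σ' n = σ n) ∧ ∀ n, σ' (2 * m - n) = σ n + 1

theorem IsFlip.isMirror {σ σ' : ℤ → ZMod 2} {m : ℤ} (h : IsFlip σ σ' m) : IsMirror σ m := by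
  intro k hk
  rw [← h.1 _ (by omega), h.2]

theorem IsFlip.eq {σ σ' σ'' : ℤ → ZMod 2} {m : ℤ} (h : IsFlip σ σ' m) (h' : IsFlip σ σ'' m) :
    σ' = σ'' := by
  funext k
  have h1 := h.2 (2 * m - k)
  have h2 := h'.2 (2 * m - k)
  rw [sub_sub_cancel] at h1 h2
  rw [h1, h2]

theorem IsFlip.symm {σ σ' : ℤ → ZMod 2} {m : ℤ} (h : IsFlip σ σ' m) : IsFlip σ' σ m := by
  refine ⟨fun n hn => (h.1 n hn).symm, fun n => ?_⟩
  have h1 := h.2 (2 * m - n)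
  rw [sub_sub_cancel] at h1
  rw [h1, add_assoc, CharTwo.add_self_eq_zero, add_zero]

theorem IsFlip.isMirror_reflect {σ σ' : ℤ → ZMod 2} {m n : ℤ} (h : IsFlip σ σ' n)
    (h' : IsMirror σ' m) : IsMirror σ (2 * n - m) := by
  intro k hk
  have h1 := h.2 (2 * (2 * n - m) - k)
  rw [show 2 * n - (2 * (2 * n - m) - k) = 2 * m - (2 * n - k) by ring, h' _ (by omega),
    h.2 k] at h1
  exact (add_right_cancel h1).symm

/-- Sign sequences attached to the vertices of a connected graph, such that adjacent
vertices have equal sequences or are related by a flip, are monotone when the set of sequences is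
invariant under the shift by `2`. -/
theorem eq_one_of_connected {G : SimpleGraph X} (hG : G.Connected) (e : X → ℤ → ZMod 2)
    (hdesc : ∀ c, IsDescending (e c))
    (hadj : ∀ a b, G.Adj a b → e a = e b ∨ ∃ m, IsFlip (e a) (e b) m)
    (hshift : ∀ c, ∃ c', ∀ n, e c' (n + 2) = e c n) (c : X) {k l : ℤ} (hkl : k ≤ l)
    (hl : e c l = 1) : e c k = 1 := by
  by_cases htwo : ∃ m n, m < n ∧ IsMirror (e c) m ∧ IsMirror (e c) n
  · obtain ⟨m, n, hmn, hm, hn⟩ := htwo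
    exact (hdesc c).eq_one_of_isMirror hmn hm hn hkl hl
  -- With at most one mirror, only `e c` and one flip of it can occur. The shifts of `e c` by 2 and
  -- by 4 both differ from `e c`, so they coincide, which makes a descending sequence periodic.
  exfalso
  have huniq : ∀ m n, IsMirror (e c) m → IsMirror (e c) n → m = n := by
    intro m n hm hn
    by_contra hmn
    rcases lt_or_gt_of_ne hmn with h | h
    · exact htwo ⟨m, n, h, hm, hn⟩
    · exact htwo ⟨n, m, h, hn, hm⟩
  have hall : ∀ b, e b = e c ∨ ∃ m, IsFlip (e c) (e b) m := by
    intro b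
    obtain ⟨p⟩ := hG.preconnected b c
    induction p with
    | nil => exact Or.inl rfl
    | @cons b b' c hbb p ih =>
      rcases hadj _ _ hbb.symm with h | ⟨m, hm⟩
      · exact h ▸ ih hl htwo huniq
      · rcases ih hl htwo huniq with h | ⟨n, hn⟩
        · exact Or.inr ⟨m, h ▸ hm⟩
        · left
          have h1 := huniq _ _ (hn.isMirror_reflect hm.isMirror) hn.isMirror
          obtain rfl : m = n := by omega
          exact hm.eq hn.symm
  have hflip : ∀ b b', e b ≠ e c → e b' ≠ e c → e b = e b' := by
    intro b b' hb hb'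
    obtain ⟨m, hm⟩ := (hall b).resolve_left hb
    obtain ⟨n, hn⟩ := (hall b').resolve_left hb'
    obtain rfl := huniq _ _ hm.isMirror hn.isMirror
    exact hm.eq hn
  obtain ⟨c₁, h₁⟩ := hshift c
  obtain ⟨c₂, h₂⟩ := hshift c₁
  refine (hdesc c₁).not_periodic (q := 2) (by norm_num) 0 fun i => ?_
  rw [← h₂ (0 + 2 * i), show 0 + 2 * (i + 1) = 0 + 2 * i + 2 by ring]
  refine congrFun (hflip c₁ c₂ ?_ ?_) _
  · intro h
    refine (hdesc c).not_periodic (q := 2) (by norm_num) 0 fun i => ?_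
    rw [show 0 + 2 * (i + 1) = 0 + 2 * i + 2 by ring, ← h₁ (0 + 2 * i), h]
  · intro h
    refine (hdesc c).not_periodic (q := 4) (by norm_num) 0 fun i => ?_
    rw [show 0 + 4 * (i + 1) = 0 + 4 * i + 2 + 2 by ring, ← h₁ (0 + 4 * i), ← h₂, h]

/-! ### Crossing walls -/

theorem eventually_eq_of_finite {σ σ' : ℤ → ZMod 2} (h : {n | σ n ≠ σ' n}.Finite) :
    ∃ N : ℤ, ∀ n, N ≤ n → σ n = σ' n ∧ σ (-n) = σ' (-n) := by
  obtain ⟨a, ha⟩ := h.bddAbove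
  obtain ⟨b, hb⟩ := h.bddBelow
  refine ⟨max (a + 1) (-b + 1), fun n hn => ⟨?_, ?_⟩⟩ <;> by_contra hne
  · have := ha hne
    omega
  · have := hb hne
    omega

/-- Sign sequences that are compatible with a shift and a reflection become descending after
adding a `2`-periodic sequence. -/
theorem exists_periodic_isDescending {e : X → ℤ → ZMod 2}
    (hfin : ∀ a b, {n | e a n ≠ e b n}.Finite)
    (hshift : ∀ c, ∃ c', ∀ n, e c' (n + 2) = e c n)
    (hrefl : ∀ c, ∃ c', ∀ n, e c' (-n) = e c n + 1) (c₀ : X) :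
    ∃ p : ℤ → ZMod 2, (∀ n, p (n + 2) = p n) ∧ (∀ n, p (-n) = p n) ∧
      ∀ c, IsDescending fun n => e c n + p n := by
  obtain ⟨c₁, h₁⟩ := hshift c₀
  obtain ⟨c₂, h₂⟩ := hrefl c₀
  obtain ⟨N₁, hN₁⟩ := eventually_eq_of_finite (hfin c₀ c₁)
  obtain ⟨N₂, hN₂⟩ := eventually_eq_of_finite (hfin c₀ c₂)
  -- From `K` on, `e c₀` has period 2; `p` extends this tail to all of `ℤ`, reading it at `2 * K`
  -- and `2 * K + 1`.
  set K := max N₁ 0 with hK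
  have hper : ∀ i : ℕ, ∀ n, K ≤ n → e c₀ (n + 2 * i) = e c₀ n := by
    intro i
    induction i with
    | zero => simp
    | succ i ih =>
      intro n hn
      have h3 := h₁ (n + 2 * i)
      rw [← (hN₁ _ (by omega)).1, ih n hn] at h3
      rw [← h3]
      congr 1
      push_cast
      ring
  have hp : ∀ n, 2 * K + 1 ≤ n → e c₀ n = e c₀ (n % 2 + 2 * K) := by
    intro n hn
    rw [← hper ((n - (n % 2 + 2 * K)) / 2).toNat (n % 2 + 2 * K) (by omega)]
    congr 1
    omega
  refine ⟨fun n => e c₀ (n % 2 + 2 * K), fun n => by simp, fun n => ?_, fun c => ?_⟩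
  · have : -n % 2 = n % 2 := by omega
    simp only [this]
  · obtain ⟨N₃, hN₃⟩ := eventually_eq_of_finite (hfin c c₀)
    refine ⟨max (2 * K + 1) (max N₂ N₃), fun n hn => ?_⟩
    have h3 := hN₃ n (by omega)
    have h4 : -n % 2 = n % 2 := by omega
    simp only [h4]
    rw [h3.1, h3.2, (hN₂ n (by omega)).2, h₂, ← hp n (by omega)]
    generalize e c₀ n = x
    revert x
    decide

/-- Let `e` be a family of sign sequences attached to the vertices of a connected graph as above.
Not all sign patterns occur at two given positions. -/
theorem not_all_patterns {G : SimpleGraph X} (hG : G.Connected) (e : X → ℤ → ZMod 2)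
    (hfin : ∀ a b, {n | e a n ≠ e b n}.Finite)
    (hadj : ∀ a b, G.Adj a b → e a = e b ∨ ∃ m, IsFlip (e a) (e b) m)
    (hshift : ∀ c, ∃ c', ∀ n, e c' (n + 2) = e c n)
    (hrefl : ∀ c, ∃ c', ∀ n, e c' (-n) = e c n + 1) {k l : ℤ} (hkl : k ≤ l) :
    ¬ ∀ x y : ZMod 2, ∃ c, e c k = x ∧ e c l = y := by
  intro h
  obtain ⟨c₀, -⟩ := h 0 0
  obtain ⟨p, hp2, hpn, hp⟩ := exists_periodic_isDescending hfin hshift hrefl c₀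
  -- After adding `p`, this pattern is `0` at `k` and `1` at `l`, which monotonicity forbids.
  obtain ⟨c, hk, hl⟩ := h (p k) (p l + 1)
  have hpi : ∀ i : ℤ, ∀ n, p (n + 2 * i) = p n := by
    intro i
    induction i using Int.induction_on with
    | zero => simp
    | succ i ih =>
      intro n
      rw [← ih n, ← hp2 (n + 2 * i)]
      congr 1
      ring
    | pred i ih =>
      intro n
      rw [← ih n, ← hp2]
      congr 1
      ring
  have := eq_one_of_connected hG (fun c n => e c n + p n) hp ?_ ?_ c hkl ?_
  · simp only [hk, CharTwo.add_self_eq_zero] at this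
    exact zero_ne_one this
  · intro a b hab
    rcases hadj a b hab with h | ⟨m, h1, h2⟩
    · exact Or.inl (by rw [h])
    · refine Or.inr ⟨m, fun n hn => by simp only [h1 n hn], fun n => ?_⟩
      change e b _ + p _ = e a n + p n + 1
      rw [h2, show 2 * m - n = -n + 2 * m by ring, hpi, hpn]
      ring
  · intro c
    obtain ⟨c', hc'⟩ := hshift c
    exact ⟨c', fun n => by rw [hc', hp2]⟩
  · simp only [hl]
    rw [add_right_comm, CharTwo.add_self_eq_zero, zero_add]

/-! ### Pairs of reflections with crossing walls -/

variable {B W : Type*} [Group W] {M : CoxeterMatrix B} (cs : CoxeterSystem M W)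

/-- The walls of two reflections cross: each of the four intersections of their roots contains
a chamber. -/
def Cross (t t' : W) : Prop := ∀ x y : ZMod 2, ∃ c, side cs t c = x ∧ side cs t' c = y

/-- The sides of `c` with respect to the walls of the reflections `(t t') ^ n t`. -/
def dihedralSide (t t' c : W) (n : ℤ) : ZMod 2 :=
  if n % 2 = 0 then side cs t ((t * t') ^ (-(n / 2)) * c)
  else side cs t' ((t * t') ^ (-(n / 2 + 1)) * c)

theorem side_zpow_mul (t u c : W) (k : ℤ) (a : W) :
    side cs t (u ^ (-k) * c) = side cs t (u ^ (-k) * a) ↔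
      side cs (u ^ k * t * (u ^ k)⁻¹) c = side cs (u ^ k * t * (u ^ k)⁻¹) a := by
  rw [← side_conj_eq_iff cs (u ^ k)]
  simp

theorem dihedral_zpow_conj {t t' : W} (ht : t * t = 1) (ht' : t' * t' = 1) (m : ℤ) :
    t * (t * t') ^ m = (t * t') ^ (-m) * t ∧ t' * (t * t') ^ m = (t * t') ^ (-m) * t' := by
  have hi : t⁻¹ = t := inv_eq_of_mul_eq_one_left ht
  have hi' : t'⁻¹ = t' := inv_eq_of_mul_eq_one_left ht'
  have h1 : t * (t * t') * t⁻¹ = (t * t')⁻¹ := by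
    rw [mul_inv_rev, hi, hi', ← mul_assoc, ht, one_mul]
  have h2 : t' * (t * t') * t'⁻¹ = (t * t')⁻¹ := by
    simp only [mul_inv_rev, hi, hi', mul_assoc, ht', mul_one]
  constructor
  · rw [← mul_inv_eq_iff_eq_mul, ← conj_zpow, h1, inv_zpow, zpow_neg]
  · rw [← mul_inv_eq_iff_eq_mul, ← conj_zpow, h2, inv_zpow, zpow_neg]

/-- Evaluating `t` and `t'` at translates of `c`, rather than their conjugates at `c`, fixes the
labels of the sides so that the shift is exact. -/
theorem dihedralSide_shift (t t' c : W) (m n : ℤ) :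
    dihedralSide cs t t' ((t * t') ^ m * c) (n + 2 * m) = dihedralSide cs t t' c n := by
  have h : (n + 2 * m) % 2 = n % 2 := by omega
  have h' : (n + 2 * m) / 2 = n / 2 + m := by omega
  rw [dihedralSide, dihedralSide, h, h', ← mul_assoc, ← mul_assoc, ← zpow_add, ← zpow_add]
  congr <;> ring

theorem dihedralSide_reflect {t t' : W} (ht : cs.IsReflection t) (ht' : cs.IsReflection t') (c : W)
    (n : ℤ) : dihedralSide cs t t' (t * c) (-n) = dihedralSide cs t t' c n + 1 := by
  have hconj (m : ℤ) := dihedral_zpow_conj ht.mul_self ht'.mul_self m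
  rw [dihedralSide, dihedralSide]
  by_cases hn : n % 2 = 0
  · rw [if_pos hn, if_pos (by omega), ← side_reflection_mul cs ht, ← mul_assoc, ← mul_assoc,
      (hconj _).1]
    congr 3
    congr 1
    omega
  · rw [if_neg hn, if_neg (by omega), ← side_reflection_mul cs ht', ← mul_assoc, ← mul_assoc,
      (hconj _).2, show -(-(n / 2 + 1)) = -(-n / 2 + 1) + 1 by omega, zpow_add, zpow_one]
    simp only [mul_assoc, ht'.mul_self, mul_one]

theorem dihedralSide_ne_iff {t t' : W} (ht : cs.IsReflection t) (ht' : cs.IsReflection t')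
    (a b : W) (n : ℤ) : dihedralSide cs t t' a n ≠ dihedralSide cs t t' b n ↔
      side cs ((t * t') ^ n * t) a ≠ side cs ((t * t') ^ n * t) b := by
  have hconj (m : ℤ) := dihedral_zpow_conj ht.mul_self ht'.mul_self m
  rw [dihedralSide, dihedralSide]
  split_ifs with hn
  · rw [Ne, side_zpow_mul, Ne]
    have : (t * t') ^ (n / 2) * t * ((t * t') ^ (n / 2))⁻¹ = (t * t') ^ n * t := by
      rw [mul_assoc, ← zpow_neg, (hconj _).1, ← mul_assoc, ← zpow_add]
      congr 2
      omega
    rw [this]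
  · rw [Ne, side_zpow_mul, Ne]
    have : (t * t') ^ (n / 2 + 1) * t' * ((t * t') ^ (n / 2 + 1))⁻¹ = (t * t') ^ n * t := by
      rw [mul_assoc, ← zpow_neg, (hconj _).2, ← mul_assoc, ← zpow_add,
        show n / 2 + 1 + - -(n / 2 + 1) = n + 1 by omega, zpow_add, zpow_one]
      simp only [mul_assoc, ht'.mul_self, mul_one]
    rw [this]

/-- If the walls of two reflections cross, then the product of the reflections has finite order. -/
theorem Cross.isOfFinOrder {t t' : W} (ht : cs.IsReflection t) (ht' : cs.IsReflection t')
    (h : Cross cs t t') : IsOfFinOrder (t * t') := by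
  by_contra hinf
  have hinj : Function.Injective fun n : ℤ => (t * t') ^ n * t := fun m n hmn =>
    injective_zpow_iff_not_isOfFinOrder.2 hinf (mul_right_cancel hmn)
  -- Position `0` is the wall of `t` and position `-1` that of `t'`.
  refine not_all_patterns (complex_connected cs) (dihedralSide cs t t') ?_ ?_ ?_ ?_
    (show (-1 : ℤ) ≤ 0 by norm_num) ?_
  · intro a b
    simp only [dihedralSide_ne_iff cs ht ht']
    exact (finite_separating cs a b).preimage hinj.injOn
  · intro a b hab
    by_cases hm : ∃ m : ℤ, (t * t') ^ m * t = b * a⁻¹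
    · right
      obtain ⟨m, hm⟩ := hm
      refine ⟨m, fun n hn => ?_, fun n => ?_⟩
      · by_contra hne
        rw [eq_comm, ← ne_eq, dihedralSide_ne_iff cs ht ht', side_ne_iff_of_adj cs hab, ← hm] at hne
        exact hn (hinj hne)
      -- Crossing the wall at position `m` is the reflection about `0` followed by the shift by `2 *
      -- m`.
      · have hb : b = (t * t') ^ m * (t * a) := by
          rw [← mul_assoc, hm, inv_mul_cancel_right]
        rw [hb, show 2 * m - n = -n + 2 * m by ring, dihedralSide_shift,
          dihedralSide_reflect cs ht ht']
    · left
      funext n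
      by_contra hne
      rw [← ne_eq, dihedralSide_ne_iff cs ht ht', side_ne_iff_of_adj cs hab] at hne
      exact hm ⟨n, hne⟩
  · exact fun c => ⟨(t * t') ^ (1 : ℤ) * c, fun n => dihedralSide_shift cs t t' c 1 n⟩
  · exact fun c => ⟨t * c, dihedralSide_reflect cs ht ht' c⟩
  · intro x y
    obtain ⟨c, hx, hy⟩ := h y x
    refine ⟨c, ?_, ?_⟩
    · simpa [dihedralSide] using hy
    · simpa [dihedralSide] using hx

end

end CoxeterTrees

/-! ### Projections, and finite approximation of boundary points -/

namespace ChamberGraph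

variable {V : Type*} (X : ChamberGraph V)

theorem projChamber_singleton (a c : V) : X.projChamber {a} c = {a} := by
  ext d
  constructor
  · exact fun h => h.1
  · rintro rfl
    exact ⟨rfl, fun e he => by rw [mem_singleton_iff.1 he]⟩

theorem projChamber_pair {a b c : V} (h : X.graph.dist c a < X.graph.dist c b) :
    X.projChamber {a, b} c = {a} := by
  ext d
  constructor
  · rintro ⟨rfl | rfl, hd⟩
    · rfl
    · exact absurd (hd a (Or.inl rfl)) (not_le.2 h)
  · rintro rfl
    refine ⟨Or.inl rfl, ?_⟩
    rintro e (rfl | rfl)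
    · exact le_rfl
    · exact h.le

theorem mem_proj {R A : Set V} {d : V} : d ∈ X.proj R A ↔ ∃ c ∈ A, d ∈ X.projChamber R c := by
  simp [proj]

theorem proj_subset (R A : Set V) : X.proj R A ⊆ R := by
  intro d hd
  obtain ⟨c, -, h⟩ := X.mem_proj.1 hd
  exact h.1

theorem projChamber_nonempty {R : Set V} (hR : R.Nonempty) (c : V) :
    (X.projChamber R c).Nonempty := by
  exact ⟨Function.argminOn (X.graph.dist c) R hR, Function.argminOn_mem _ _ hR,
    fun e he => Function.argminOn_le _ R he⟩

/-- Points of the bordification agree with residues on every finite set of residues. -/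
theorem Csph.exists_eqOn {X : ChamberGraph V} (ξ : X.Csph) {F : Set X.Rsph} (hF : F.Finite) :
    ∃ R : X.Rsph, ∀ S ∈ F, ξ.1 S = X.proj S.1 R.1 := by
  let _ : TopologicalSpace (Set V) := ⊥
  have _ : DiscreteTopology (Set V) := ⟨rfl⟩
  have hopen : IsOpen (⋂ S ∈ F, {η : X.Rsph → Set V | η S = ξ.1 S}) :=
    hF.isOpen_biInter fun S _ =>
      (isOpen_discrete {ξ.1 S}).preimage (continuous_apply (A := fun _ : X.Rsph => Set V) S)
  obtain ⟨_, hη, R, rfl⟩ := mem_closure_iff.1 ξ.2 _ hopen (by simp)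
  exact ⟨R, fun S hS => (mem_iInter₂.1 hη S hS).symm⟩

theorem mem_closure_of_forall_finite {X : ChamberGraph V} {ξ : X.Rsph → Set V}
    (h : ∀ F : Set X.Rsph, F.Finite → ∃ R : X.Rsph, ∀ S ∈ F, ξ S = X.proj S.1 R.1) :
    ξ ∈ @closure _ X.productTopology (range X.piRes) := by
  let _ : TopologicalSpace (Set V) := ⊥
  refine mem_closure_iff.2 fun o ho hξ => ?_
  obtain ⟨I, u, hu, hsub⟩ := isOpen_pi_iff.1 ho ξ hξ
  obtain ⟨R, hR⟩ := h I I.finite_toSet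
  refine ⟨X.piRes R, hsub fun S hS => ?_, mem_range_self R⟩
  have := (hu S hS).2
  rwa [hR S hS] at this

end ChamberGraph

namespace CoxeterTrees

open ChamberGraph

noncomputable section

variable {B W : Type*} [Group W] {M : CoxeterMatrix B} (cs : CoxeterSystem M W)

/-! ### Residues of the Coxeter complex -/

theorem projChamber_panel {a b c : W} (hab : (complex cs).graph.Adj a b)
    (h : side cs (b * a⁻¹) c = side cs (b * a⁻¹) a) :
    (complex cs).projChamber {a, b} c = {a} := by
  apply projChamber_pair
  simpa using dist_lt_reflection cs (isReflection_of_adj cs hab) h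

/-- The wall of `t` crosses the set of chambers `R`. -/
def Crosses (t : W) (R : Set W) : Prop := ∃ a ∈ R, ∃ b ∈ R, side cs t a ≠ side cs t b

theorem sph_nonempty {R : Set W} (hR : R ∈ (complex cs).sph) : R.Nonempty := by
  obtain ⟨w, J, -, rfl⟩ := hR
  exact ⟨_, mem_image_of_mem _ (Subgroup.one_mem _)⟩

theorem sph_finite {R : Set W} (hR : R ∈ (complex cs).sph) : R.Finite := by
  obtain ⟨w, J, hJ, rfl⟩ := hR
  exact hJ.image _

theorem singleton_mem_sph (a : W) : {a} ∈ (complex cs).sph :=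
  ⟨a, ∅, by simp, by simp⟩

theorem panel_mem_sph {a b : W} (h : (complex cs).graph.Adj a b) : {a, b} ∈ (complex cs).sph := by
  obtain ⟨i, rfl⟩ := (adj_iff cs a b).1 h
  have hcl : (Subgroup.closure (cs.simple '' {i}) : Set W) = {1, cs.simple i} := by
    ext g
    rw [image_singleton, SetLike.mem_coe, Subgroup.mem_closure_singleton]
    constructor
    · rintro ⟨n, rfl⟩
      rcases Int.even_or_odd' n with ⟨k, rfl | rfl⟩
      · left
        rw [zpow_mul, zpow_ofNat, cs.simple_sq, one_zpow]
      · right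
        rw [zpow_add, zpow_mul, zpow_ofNat, cs.simple_sq, one_zpow, one_mul, zpow_one]
        rfl
    · rintro (rfl | rfl)
      · exact ⟨0, zpow_zero _⟩
      · exact ⟨1, zpow_one _⟩
  refine ⟨a, {i}, ?_, ?_⟩
  · rw [hcl]
    exact toFinite _
  · rw [hcl, image_pair, mul_one]

/-- A gallery inside the residue that joins the two sides must cross the wall. -/
theorem exists_panel_of_crosses {R : Set W} (hR : R ∈ (complex cs).sph) {t : W}
    (h : Crosses cs t R) :
    ∃ x ∈ R, ∃ y ∈ R, (complex cs).graph.Adj x y ∧ y * x⁻¹ = t := by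
  obtain ⟨w, J, -, rfl⟩ := hR
  obtain ⟨_, ⟨u, hu, rfl⟩, _, ⟨v, hv, rfl⟩, huv⟩ := h
  suffices key : ∀ v ∈ Subgroup.closure (cs.simple '' J), side cs t w ≠ side cs t (w * v) →
      ∃ x ∈ (w * ·) '' (Subgroup.closure (cs.simple '' J) : Set W),
      ∃ y ∈ (w * ·) '' (Subgroup.closure (cs.simple '' J) : Set W),
      (complex cs).graph.Adj x y ∧ y * x⁻¹ = t by
    by_cases hwu : side cs t w = side cs t (w * u)
    · exact key v hv (hwu ▸ huv)
    · exact key u hu hwu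
  intro v hv
  induction hv using Subgroup.closure_induction_right with
  | one => simp
  | mul_right x hx y hy ih =>
    obtain ⟨i, hi, rfl⟩ := hy
    intro hne
    by_cases hs : side cs t w = side cs t (w * x)
    · have hadj : (complex cs).graph.Adj (w * x) (w * (x * cs.simple i)) :=
        (adj_iff cs _ _).2 ⟨i, by rw [mul_assoc]⟩
      exact ⟨_, ⟨x, hx, rfl⟩, _,
        ⟨_, mul_mem hx (Subgroup.subset_closure ⟨i, hi, rfl⟩), rfl⟩, hadj,
        ((side_ne_iff_of_adj cs hadj t).1 (hs ▸ hne)).symm⟩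
    · exact ih hs
  | mul_inv_cancel x hx y hy ih =>
    obtain ⟨i, hi, rfl⟩ := hy
    rw [cs.inv_simple]
    intro hne
    by_cases hs : side cs t w = side cs t (w * x)
    · have hadj : (complex cs).graph.Adj (w * x) (w * (x * cs.simple i)) :=
        (adj_iff cs _ _).2 ⟨i, by rw [mul_assoc]⟩
      exact ⟨_, ⟨x, hx, rfl⟩, _,
        ⟨_, mul_mem hx (Subgroup.subset_closure ⟨i, hi, rfl⟩), rfl⟩, hadj,
        ((side_ne_iff_of_adj cs hadj t).1 (hs ▸ hne)).symm⟩
    · exact ih hs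

/-- By the previous lemma, `t` lies in `w W_J w⁻¹`, the stabiliser of `R = w W_J`. -/
theorem mul_mem_of_crosses {R : Set W} (hR : R ∈ (complex cs).sph) {t x : W}
    (h : Crosses cs t R) (hx : x ∈ R) : t * x ∈ R := by
  obtain ⟨a, ha, b, hb, -, rfl⟩ := exists_panel_of_crosses cs hR h
  obtain ⟨w, J, -, rfl⟩ := hR
  obtain ⟨a, ha, rfl⟩ := ha
  obtain ⟨b, hb, rfl⟩ := hb
  obtain ⟨x, hx, rfl⟩ := hx
  exact ⟨b * a⁻¹ * x, mul_mem (mul_mem hb (inv_mem ha)) hx, by group⟩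

/-- The powers of `t * t'` move a chamber within the finite set `R`. -/
theorem isOfFinOrder_mul_of_crosses {R : Set W} (hR : R ∈ (complex cs).sph) {t t' : W}
    (h : Crosses cs t R) (h' : Crosses cs t' R) : IsOfFinOrder (t * t') := by
  obtain ⟨x, hx⟩ := sph_nonempty cs hR
  have hmem : ∀ n : ℕ, (t * t') ^ n * x ∈ R := by
    intro n
    induction n with
    | zero => simpa
    | succ n ih =>
      rw [pow_succ', mul_assoc, mul_assoc]
      exact mul_mem_of_crosses cs hR h (mul_mem_of_crosses cs hR h' ih)
  by_contra hinf
  refine Set.infinite_of_injective_forall_mem (f := fun n : ℕ => (t * t') ^ n * x) ?_ hmem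
    (sph_finite cs hR)
  intro m n hmn
  exact injective_pow_iff_not_isOfFinOrder.2 hinf (mul_right_cancel hmn)

/-- If a wall crossing `R` separated `c` from a nearest chamber of `R`, reflecting that chamber
would give a nearer one in `R`. Conversely, chambers of `R` are told apart by the walls crossing
`R`. -/
theorem mem_projChamber_iff {R : Set W} (hR : R ∈ (complex cs).sph) {c d : W} :
    d ∈ (complex cs).projChamber R c ↔
      d ∈ R ∧ ∀ t, Crosses cs t R → side cs t c = side cs t d := by
  have key : ∀ d ∈ (complex cs).projChamber R c, ∀ t, Crosses cs t R →
      side cs t c = side cs t d := by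
    intro d hd t ht
    by_contra hne
    exact (dist_reflection_lt cs hne).not_ge (hd.2 _ (mul_mem_of_crosses cs hR ht hd.1))
  refine ⟨fun h => ⟨h.1, key d h⟩, fun ⟨hd, h⟩ => ?_⟩
  obtain ⟨e, he⟩ := (complex cs).projChamber_nonempty (sph_nonempty cs hR) c
  convert he
  refine eq_of_forall_side_eq cs fun t _ => ?_
  by_contra hne
  have ht : Crosses cs t R := ⟨d, hd, e, he.1, hne⟩
  exact hne ((h t ht).symm.trans (key e he t ht))

/-- The projection of a residue `R` to a residue `S` is determined by the walls that cross `S`. -/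
theorem mem_proj_iff {R S : Set W} (hR : R ∈ (complex cs).sph) (hS : S ∈ (complex cs).sph)
    {d : W} : d ∈ (complex cs).proj S R ↔
      d ∈ S ∧ ∀ t, Crosses cs t S → ∃ c ∈ R, side cs t c = side cs t d := by
  constructor
  · intro hd
    obtain ⟨c, hc, h⟩ := (complex cs).mem_proj.1 hd
    rw [mem_projChamber_iff cs hS] at h
    exact ⟨h.1, fun t ht => ⟨c, hc, h.2 t ht⟩⟩
  rintro ⟨hd, h⟩
  -- Move from a known projection `d₀` to `d` one panel at a time, by induction on the distance.
  have key : ∀ n, ∀ d₀ ∈ (complex cs).proj S R, (complex cs).graph.dist d₀ d = n →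
      d ∈ (complex cs).proj S R := by
    intro n
    induction n using Nat.strong_induction_on with
    | _ n ih =>
      intro d₀ hd₀ hn
      by_cases heq : d₀ = d
      · exact heq ▸ hd₀
      obtain ⟨d₁, hadj, hsep, hlt⟩ := exists_adj_separating cs heq
      refine ih _ (hn ▸ hlt) d₁ ?_ rfl
      set t := d₁ * d₀⁻¹ with ht
      have hd₁ : t * d₀ = d₁ := by rw [ht, inv_mul_cancel_right]
      have htS : Crosses cs t S := ⟨d₀, (complex cs).proj_subset _ _ hd₀, d, hd, hsep⟩
      obtain ⟨c₀, hc₀, hp⟩ := (complex cs).mem_proj.1 hd₀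
      rw [mem_projChamber_iff cs hS] at hp
      obtain ⟨c, hc, hcd⟩ := h t htS
      -- The wall of `t` separates `c₀` from `c` as it separates `d₀` from `d`. So `t` preserves
      -- both `R` and `S`, and `d₁ = t * d₀` is the projection of `t * c₀`.
      have htR : Crosses cs t R := ⟨c₀, hc₀, c, hc, by rwa [hp.2 t htS, hcd]⟩
      refine (complex cs).mem_proj.2 ⟨t * c₀, mul_mem_of_crosses cs hR htR hc₀, ?_⟩
      rw [mem_projChamber_iff cs hS, ← hd₁]
      refine ⟨mul_mem_of_crosses cs hS htS hp.1, fun t' ht' => ?_⟩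
      obtain ⟨a, ha, b, hb, hab⟩ := ht'
      have htt : t * t = 1 := (isReflection_of_adj cs hadj).mul_self
      have htt' : t * (t⁻¹ * t' * t) * t⁻¹ = t' := by group
      have hconj := side_conj_eq_iff cs t (t⁻¹ * t' * t)
      rw [htt'] at hconj
      refine (hconj _ _).2 (hp.2 _ ⟨t * a, mul_mem_of_crosses cs hS htS ha, t * b,
        mul_mem_of_crosses cs hS htS hb, ?_⟩)
      rwa [Ne, ← hconj, ← mul_assoc t t a, ← mul_assoc t t b, htt, one_mul, one_mul]
  obtain ⟨c₀, hc₀⟩ := sph_nonempty cs hR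
  obtain ⟨d₀, hd₀⟩ := (complex cs).projChamber_nonempty (sph_nonempty cs hS) c₀
  exact key _ d₀ ((complex cs).mem_proj.2 ⟨c₀, hc₀, hd₀⟩) rfl

/-- Every wall crossing `S` contains a panel of `S`, and the projection to that panel records which
sides of the wall the residue meets. -/
theorem proj_subset_of_panels {R R' S : Set W} (hR : R ∈ (complex cs).sph)
    (hR' : R' ∈ (complex cs).sph) (hS : S ∈ (complex cs).sph)
    (h : ∀ x ∈ S, ∀ y ∈ S, (complex cs).graph.Adj x y →
      (complex cs).proj {x, y} R = (complex cs).proj {x, y} R') :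
    (complex cs).proj S R ⊆ (complex cs).proj S R' := by
  intro d hd
  rw [mem_proj_iff cs hR hS] at hd
  rw [mem_proj_iff cs hR' hS]
  refine ⟨hd.1, fun t ht => ?_⟩
  suffices key : ∃ x ∈ S, ∃ y ∈ S, (complex cs).graph.Adj x y ∧ y * x⁻¹ = t ∧
      side cs t x = side cs t d by
    obtain ⟨x, hx, y, hy, hxy, rfl, hxd⟩ := key
    obtain ⟨c, hc, hcd⟩ := hd.2 _ ht
    have h1 : x ∈ (complex cs).proj {x, y} R := by
      refine (complex cs).mem_proj.2 ⟨c, hc, ?_⟩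
      rw [projChamber_panel cs hxy (hcd.trans hxd.symm)]
      rfl
    rw [h x hx y hy hxy] at h1
    obtain ⟨c', hc', hp⟩ := (complex cs).mem_proj.1 h1
    refine ⟨c', hc', ?_⟩
    rw [← hxd]
    refine ((mem_projChamber_iff cs (panel_mem_sph cs hxy)).1 hp).2 _
      ⟨x, Or.inl rfl, y, Or.inr rfl, ?_⟩
    rw [side_ne_iff_of_adj cs hxy]
  obtain ⟨x, hx, y, hy, hxy, rfl⟩ := exists_panel_of_crosses cs hS ht
  by_cases hxd : side cs (y * x⁻¹) x = side cs (y * x⁻¹) d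
  · exact ⟨x, hx, y, hy, hxy, rfl, hxd⟩
  · refine ⟨y, hy, x, hx, hxy.symm, adj_reflection_symm cs hxy, ?_⟩
    have h2 := (side_ne_iff_of_adj cs hxy (y * x⁻¹)).2 rfl
    generalize side cs (y * x⁻¹) x = p at *
    generalize side cs (y * x⁻¹) y = q at *
    generalize side cs (y * x⁻¹) d = r at *
    revert p q r
    decide

/-- A point of the bordification of the Coxeter complex is determined by its values on panels. -/
theorem Csph_ext {ξ ξ' : (complex cs).Csph}
    (h : ∀ x y, ∀ hxy : (complex cs).graph.Adj x y,
      ξ.1 ⟨{x, y}, panel_mem_sph cs hxy⟩ = ξ'.1 ⟨{x, y}, panel_mem_sph cs hxy⟩) : ξ = ξ' := by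
  refine Subtype.ext (funext fun S => ?_)
  -- Only finitely many residues lie in `S`, so on these both points agree with genuine residues.
  have hF : {P : (complex cs).Rsph | P.1 ⊆ S.1}.Finite :=
    (sph_finite cs S.2).finite_subsets.preimage Subtype.val_injective.injOn
  obtain ⟨R, hR⟩ := ξ.exists_eqOn hF
  obtain ⟨R', hR'⟩ := ξ'.exists_eqOn hF
  have hpan : ∀ x ∈ S.1, ∀ y ∈ S.1, (complex cs).graph.Adj x y →
      (complex cs).proj {x, y} R.1 = (complex cs).proj {x, y} R'.1 := by
    intro x hx y hy hxy
    have hsub : ({x, y} : Set W) ⊆ S.1 := insert_subset hx (singleton_subset_iff.2 hy)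
    rw [← hR ⟨_, panel_mem_sph cs hxy⟩ hsub, ← hR' ⟨_, panel_mem_sph cs hxy⟩ hsub, h x y hxy]
  rw [hR S (subset_refl S.1), hR' S (subset_refl S.1)]
  exact Subset.antisymm (proj_subset_of_panels cs R.2 R'.2 S.2 hpan)
    (proj_subset_of_panels cs R'.2 R.2 S.2 fun x hx y hy hxy => (hpan x hx y hy hxy).symm)

end

end CoxeterTrees

namespace CoxeterTrees

open ChamberGraph

noncomputable section

variable {B W : Type*} [Group W] {M : CoxeterMatrix B} (cs : CoxeterSystem M W)

/-! ### Walls and reflections -/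

/-- The set of panels that are stabilised by the reflection `t`. -/
def wallOf (t : W) : Set (Sym2 W) :=
  {e | ∃ x y, e = s(x, y) ∧ (complex cs).graph.Adj x y ∧ y * x⁻¹ = t}

theorem mem_wallOf {t x y : W} :
    s(x, y) ∈ wallOf cs t ↔ (complex cs).graph.Adj x y ∧ y * x⁻¹ = t := by
  constructor
  · rintro ⟨a, b, h, hab, rfl⟩
    rcases Sym2.eq_iff.1 h with ⟨rfl, rfl⟩ | ⟨rfl, rfl⟩
    · exact ⟨hab, rfl⟩
    · exact ⟨hab.symm, adj_reflection_symm cs hab⟩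
  · rintro ⟨h, rfl⟩
    exact ⟨x, y, rfl, h, rfl⟩

theorem wallOf_injOn {t t' : W} (ht : cs.IsReflection t) (h : wallOf cs t = wallOf cs t') :
    t = t' := by
  obtain ⟨x, y, hxy, rfl⟩ := exists_adj_of_isReflection cs ht
  have : s(x, y) ∈ wallOf cs t' := h ▸ (mem_wallOf cs).2 ⟨hxy, rfl⟩
  exact ((mem_wallOf cs).1 this).2

theorem moveWall_wallOf (g t : W) : moveWall g (wallOf cs t) = wallOf cs (g * t * g⁻¹) := by
  ext e
  constructor
  · rintro ⟨_, ⟨x, y, rfl, hxy, rfl⟩, rfl⟩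
    exact ⟨g * x, g * y, rfl, (adj_mul_left cs).2 hxy, by group⟩
  · rintro ⟨x, y, rfl, hxy, h⟩
    refine ⟨s(g⁻¹ * x, g⁻¹ * y), ⟨_, _, rfl, (adj_mul_left cs).2 hxy, ?_⟩, by simp⟩
    rw [mul_inv_rev, inv_inv, mul_assoc, ← mul_assoc y, h]
    group

theorem root_eq {x y : W} (h : (complex cs).graph.Adj x y) :
    {c | (complex cs).projChamber {x, y} c = {x}} =
      {c | side cs (y * x⁻¹) c = side cs (y * x⁻¹) x} := by
  ext c
  refine ⟨fun hc => ?_, fun hc => projChamber_panel cs h hc⟩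
  have hx : x ∈ (complex cs).projChamber {x, y} c := by
    rw [mem_ofPred_eq] at hc
    rw [hc]
    rfl
  refine ((mem_projChamber_iff cs (panel_mem_sph cs h)).1 hx).2 _ ⟨x, Or.inl rfl, y, Or.inr rfl, ?_⟩
  rw [side_ne_iff_of_adj cs h]

theorem isRoot_iff {α : Set W} : (complex cs).IsRoot α ↔
    ∃ x y, (complex cs).graph.Adj x y ∧ α = {c | side cs (y * x⁻¹) c = side cs (y * x⁻¹) x} := by
  constructor
  · rintro ⟨x, y, h, rfl⟩
    exact ⟨x, y, h, root_eq cs h⟩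
  · rintro ⟨x, y, h, rfl⟩
    exact ⟨x, y, h, (root_eq cs h).symm⟩

theorem wall_root (t x : W) :
    wall cs {c | side cs t c = side cs t x} = wallOf cs t := by
  ext e
  constructor
  · rintro ⟨a, b, rfl, hab, ha, hb⟩
    refine (mem_wallOf cs).2 ⟨hab, ?_⟩
    refine ((side_ne_iff_of_adj cs hab t).1 fun h => hb ?_).symm
    exact h.symm.trans ha
  · rintro ⟨a, b, rfl, hab, h⟩
    have hne := (side_ne_iff_of_adj cs hab t).2 h.symm
    by_cases ha : side cs t a = side cs t x
    · exact ⟨a, b, rfl, hab, ha, fun hb => hne (ha.trans hb.symm)⟩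
    · refine ⟨b, a, Sym2.eq_swap, hab.symm, ?_, ha⟩
      change side cs t b = side cs t x
      generalize side cs t a = p at *
      generalize side cs t b = q at *
      generalize side cs t x = r at *
      revert p q r
      decide

theorem isWall_iff {H : Set (Sym2 W)} : IsWall cs H ↔ ∃ t, cs.IsReflection t ∧ H = wallOf cs t := by
  constructor
  · rintro ⟨α, hα, rfl⟩
    obtain ⟨x, y, h, rfl⟩ := (isRoot_iff cs).1 hα
    exact ⟨_, isReflection_of_adj cs h, wall_root cs _ _⟩
  · rintro ⟨t, ht, rfl⟩
    obtain ⟨x, y, h, rfl⟩ := exists_adj_of_isReflection cs ht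
    exact ⟨_, (isRoot_iff cs).2 ⟨x, y, h, rfl⟩, (wall_root cs _ _).symm⟩

/-! ### Families of pairwise non-crossing walls -/

/-- `O` is the set of the walls of a set `C` of reflections whose walls do not cross. -/
structure IsNested (O : Set (Set (Sym2 W))) (C : Set W) : Prop where
  mem_sUnion : ∀ x y, (complex cs).graph.Adj x y → (s(x, y) ∈ ⋃₀ O ↔ y * x⁻¹ ∈ C)
  eq_of_cross : ∀ t ∈ C, ∀ t' ∈ C, Cross cs t t' → t = t'

variable {cs} {O : Set (Set (Sym2 W))} {C : Set W}

/-- The component of a chamber. -/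
abbrev comp (cs : CoxeterSystem M W) (O : Set (Set (Sym2 W))) (a : W) :
    (cutGraph cs O).ConnectedComponent := (cutGraph cs O).connectedComponentMk a

namespace IsNested

theorem cutGraph_adj (hO : IsNested cs O C) {a b : W} :
    (cutGraph cs O).Adj a b ↔ (complex cs).graph.Adj a b ∧ b * a⁻¹ ∉ C := by
  rw [cutGraph, SimpleGraph.deleteEdges_adj]
  exact and_congr_right fun h => not_congr (hO.mem_sUnion a b h)

/-- Each step of a geodesic from `a` to `b` crosses a wall separating them, hence none from `C` if
no wall of `C` separates them. -/
theorem comp_eq_iff (hO : IsNested cs O C) {a b : W} :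
    comp cs O a = comp cs O b ↔ ∀ t ∈ C, side cs t a = side cs t b := by
  constructor
  · intro h t ht
    obtain ⟨p⟩ := SimpleGraph.ConnectedComponent.exact h
    induction p with
    | nil => rfl
    | @cons a c b hac p ih =>
      rw [hO.cutGraph_adj] at hac
      rw [← ih (SimpleGraph.ConnectedComponent.sound p.reachable)]
      by_contra hne
      exact hac.2 ((side_ne_iff_of_adj cs hac.1 t).1 hne ▸ ht)
  · intro h
    induction hn : (complex cs).graph.dist a b using Nat.strong_induction_on generalizing a with
    | _ n ih =>
      by_cases hab : a = b
      · rw [hab]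
      obtain ⟨c, hac, hsep, hlt⟩ := exists_adj_separating cs hab
      have hC : c * a⁻¹ ∉ C := fun hC => hsep (h _ hC)
      have hadj : (cutGraph cs O).Adj a c := hO.cutGraph_adj.2 ⟨hac, hC⟩
      refine (SimpleGraph.ConnectedComponent.sound hadj.reachable).trans
        (ih _ (hn ▸ hlt) (fun t ht => ?_) rfl)
      rw [← h t ht]
      by_contra hne
      exact hC ((side_ne_iff_of_adj cs hac t).1 (Ne.symm hne) ▸ ht)

theorem wallTree_adj (hO : IsNested cs O C) {a b : W} (hab : (complex cs).graph.Adj a b)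
    (hC : b * a⁻¹ ∈ C) : (wallTree cs O).Adj (comp cs O a) (comp cs O b) := by
  refine ⟨fun h => ?_, a, b, rfl, rfl, hab⟩
  exact (side_ne_iff_of_adj cs hab _).2 rfl (hO.comp_eq_iff.1 h _ hC)

theorem comp_eq_of_adj (hO : IsNested cs O C) {a b : W} (hab : (complex cs).graph.Adj a b)
    (hC : b * a⁻¹ ∉ C) : comp cs O a = comp cs O b :=
  SimpleGraph.ConnectedComponent.sound
    (hO.cutGraph_adj.2 ⟨hab, hC⟩ : (cutGraph cs O).Adj a b).reachable

theorem exists_panel_of_adj (hO : IsNested cs O C) {P Q : (cutGraph cs O).ConnectedComponent}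
    (h : (wallTree cs O).Adj P Q) :
    ∃ a b, comp cs O a = P ∧ comp cs O b = Q ∧ (complex cs).graph.Adj a b ∧ b * a⁻¹ ∈ C := by
  obtain ⟨hne, a, b, rfl, rfl, hab⟩ := h
  refine ⟨a, b, rfl, rfl, hab, ?_⟩
  by_contra hC
  exact hne (hO.comp_eq_of_adj hab hC)

/-- A wall of `C` separating `x` from `a` would cross the common wall of the two panels, with `a`,
`b`, `x`, `y` in the four quadrants. Thus each wall gives only one edge. -/
theorem comp_eq_of_panels (hO : IsNested cs O C) {a b x y : W}
    (hab : (complex cs).graph.Adj a b) (hxy : (complex cs).graph.Adj x y)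
    (h : b * a⁻¹ = y * x⁻¹) (hC : b * a⁻¹ ∈ C)
    (hs : side cs (b * a⁻¹) x = side cs (b * a⁻¹) a) : comp cs O x = comp cs O a := by
  rw [hO.comp_eq_iff]
  intro t ht
  by_contra hne
  have htne : b * a⁻¹ ≠ t := by
    rintro rfl
    exact hne hs
  refine htne (hO.eq_of_cross _ hC _ ht ?_)
  have h1 : side cs t a = side cs t b := by
    by_contra h'
    exact htne ((side_ne_iff_of_adj cs hab _).1 h').symm
  have h2 : side cs t x = side cs t y := by
    by_contra h'
    exact htne (h.trans ((side_ne_iff_of_adj cs hxy _).1 h').symm)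
  have h3 := (side_ne_iff_of_adj cs hab _).2 rfl
  have h4 := (side_ne_iff_of_adj cs hxy _).2 h
  intro p q
  have hp : ∀ p u v : ZMod 2, u ≠ v → p = u ∨ p = v := by decide
  rcases hp p _ _ h3 with h5 | h5 <;> rcases hp q _ _ hne with h6 | h6
  · exact ⟨x, by rw [hs, h5], h6.symm⟩
  · exact ⟨a, h5.symm, h6.symm⟩
  · refine ⟨y, ?_, by rw [← h2, h6]⟩
    rw [h5]
    rw [hs] at h4
    have h7 : ∀ u v w : ZMod 2, u ≠ v → u ≠ w → w = v := by decide
    exact h7 _ _ _ h3 h4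
  · exact ⟨b, h5.symm, by rw [← h1, h6]⟩

/-- A walk in the tree whose ends are separated by the wall of a panel contains the edge
given by the panel. -/
theorem mem_edges_of_side_ne (hO : IsNested cs O C) {a b : W}
    (hab : (complex cs).graph.Adj a b) (hC : b * a⁻¹ ∈ C)
    {P Q : (cutGraph cs O).ConnectedComponent} (p : (wallTree cs O).Walk P Q) {z z' : W}
    (hz : comp cs O z = P) (hz' : comp cs O z' = Q)
    (hne : side cs (b * a⁻¹) z ≠ side cs (b * a⁻¹) z') :
    s(comp cs O a, comp cs O b) ∈ p.edges := by
  induction p generalizing z with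
  | nil => exact absurd (hO.comp_eq_iff.1 (hz.trans hz'.symm) _ hC) hne
  | @cons P P' Q h p ih =>
    obtain ⟨x, y, hx, hy, hxy, hxyC⟩ := hO.exists_panel_of_adj h
    rw [SimpleGraph.Walk.edges_cons, List.mem_cons]
    by_cases heq : b * a⁻¹ = y * x⁻¹
    · left
      rw [← hx, ← hy]
      have hsy := (side_ne_iff_of_adj cs hab _).2 rfl
      have hsx := (side_ne_iff_of_adj cs hxy _).2 heq
      have h2 : ∀ u v w w' : ZMod 2, u ≠ v → w ≠ w' → (w = u ∧ w' = v) ∨ (w = v ∧ w' = u) := by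
        decide
      rcases h2 _ _ _ _ hsy hsx with ⟨h3, h4⟩ | ⟨h3, h4⟩
      · rw [hO.comp_eq_of_panels hab hxy heq hC h3]
        have := adj_reflection_symm cs hab
        have h5 := hO.comp_eq_of_panels hab.symm hxy.symm
          (by rw [this, adj_reflection_symm cs hxy, heq]) (by rwa [this]) (by rw [this, h4])
        rw [h5]
      · have := adj_reflection_symm cs hab
        have h5 := hO.comp_eq_of_panels hab.symm hxy (by rw [this, heq]) (by rwa [this])
          (by rw [this, h3])
        have h6 := hO.comp_eq_of_panels hab hxy.symm (by rw [adj_reflection_symm cs hxy, heq]) hC h4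
        rw [h5, h6, Sym2.eq_swap]
    · right
      refine ih hy hz' fun h' => hne ?_
      rw [← h', hO.comp_eq_iff.1 (hz.trans hx.symm) _ hC]
      by_contra hne'
      exact heq ((side_ne_iff_of_adj cs hxy _).1 hne')

theorem isTree (hO : IsNested cs O C) : (wallTree cs O).IsTree := by
  refine ⟨?_, ?_⟩
  · have hreach : ∀ a b, (wallTree cs O).Reachable (comp cs O a) (comp cs O b) := by
      intro a b
      obtain ⟨p⟩ := (complex_connected cs).preconnected a b
      induction p with
      | nil => rfl
      | @cons a c b hac p ih =>
        by_cases hC : c * a⁻¹ ∈ C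
        · exact (hO.wallTree_adj hac hC).reachable.trans ih
        · rw [hO.comp_eq_of_adj hac hC]
          exact ih
    exact
      { preconnected := fun P Q => by
          induction P using SimpleGraph.ConnectedComponent.ind
          induction Q using SimpleGraph.ConnectedComponent.ind
          exact hreach _ _
        nonempty := ⟨comp cs O 1⟩ }
  · rw [SimpleGraph.isAcyclic_iff_forall_adj_isBridge]
    intro P Q h
    obtain ⟨a, b, rfl, rfl, hab, hC⟩ := hO.exists_panel_of_adj h
    rw [SimpleGraph.isBridge_iff_forall_walk_mem_edges]
    intro p
    exact hO.mem_edges_of_side_ne hab hC p rfl rfl ((side_ne_iff_of_adj cs hab _).2 rfl)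

/-- A geodesic from `z` to the far end of the edge uses the edge, so it meets the near end before.
-/
theorem dist_comp_lt (hO : IsNested cs O C) {a b : W} (hab : (complex cs).graph.Adj a b)
    (hC : b * a⁻¹ ∈ C) {z : W} (hz : side cs (b * a⁻¹) z = side cs (b * a⁻¹) a) :
    (wallTree cs O).dist (comp cs O z) (comp cs O a) <
      (wallTree cs O).dist (comp cs O z) (comp cs O b) := by
  classical
  obtain ⟨p, hp⟩ := hO.isTree.connected.exists_walk_length_eq_dist (comp cs O z) (comp cs O b)
  have hsep := (side_ne_iff_of_adj cs hab _).2 rfl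
  have hmem := p.fst_mem_support_of_mem_edges
    (hO.mem_edges_of_side_ne hab hC p rfl rfl (hz ▸ hsep))
  rw [← hp]
  refine ((wallTree cs O).dist_le (p.takeUntil _ hmem)).trans_lt ?_
  exact SimpleGraph.Walk.length_takeUntil_lt_length hmem (hO.wallTree_adj hab hC).ne

theorem comp_surjective (P : (cutGraph cs O).ConnectedComponent) : ∃ a, comp cs O a = P :=
  SimpleGraph.ConnectedComponent.ind (fun a => ⟨a, rfl⟩) P

/-- The projections to a panel and to its image in the tree agree. -/
theorem psi_projChamber_panel (hO : IsNested cs O C) {a b : W}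
    (hab : (complex cs).graph.Adj a b) (c : W) :
    psi cs O ((complex cs).projChamber {a, b} c) =
      (ofTree (wallTree cs O)).projChamber (psi cs O {a, b}) (comp cs O c) := by
  have key : ∀ a b, (complex cs).graph.Adj a b → side cs (b * a⁻¹) c = side cs (b * a⁻¹) a →
      psi cs O ((complex cs).projChamber {a, b} c) =
        (ofTree (wallTree cs O)).projChamber (psi cs O {a, b}) (comp cs O c) := by
    intro a b hab hs
    rw [projChamber_panel cs hab hs, psi, psi, image_singleton, image_pair]
    by_cases hC : b * a⁻¹ ∈ C
    · exact (projChamber_pair _ (hO.dist_comp_lt hab hC hs)).symm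
    · have := hO.comp_eq_of_adj hab hC
      rw [comp, comp] at this
      rw [← this, pair_eq_singleton, projChamber_singleton]
  by_cases hs : side cs (b * a⁻¹) c = side cs (b * a⁻¹) a
  · exact key a b hab hs
  · rw [pair_comm]
    refine key b a hab.symm ?_
    rw [adj_reflection_symm cs hab]
    have hsep := (side_ne_iff_of_adj cs hab _).2 rfl
    have h2 : ∀ u v w : ZMod 2, u ≠ v → w ≠ u → w = v := by decide
    exact h2 _ _ _ hsep hs

end IsNested

/-- A chamber or a panel. -/
def IsSmall (cs : CoxeterSystem M W) (R : Set W) : Prop :=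
  (∃ a, R = {a}) ∨ ∃ a b, (complex cs).graph.Adj a b ∧ R = {a, b}

theorem IsSmall.mem_sph {R : Set W} (h : IsSmall cs R) : R ∈ (complex cs).sph := by
  rcases h with ⟨a, rfl⟩ | ⟨a, b, hab, rfl⟩
  · exact singleton_mem_sph cs a
  · exact panel_mem_sph cs hab

namespace IsNested

/-- This compatibility makes `phi` independent of the representative `R`; both sides are unions over
the chambers of `A`. -/
theorem psi_proj (hO : IsNested cs O C) {R : Set W} (hR : IsSmall cs R) (A : Set W) :
    psi cs O ((complex cs).proj R A) = (ofTree (wallTree cs O)).proj (psi cs O R) (psi cs O A) := by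
  have h1 : ∀ c, psi cs O ((complex cs).projChamber R c) =
      (ofTree (wallTree cs O)).projChamber (psi cs O R) (comp cs O c) := by
    intro c
    rcases hR with ⟨a, rfl⟩ | ⟨a, b, hab, rfl⟩
    · simp only [psi, image_singleton, projChamber_singleton]
    · exact hO.psi_projChamber_panel hab c
  have h2 : psi cs O ((complex cs).proj R A) =
      ⋃ c ∈ A, psi cs O ((complex cs).projChamber R c) := by
    simp only [psi, proj, image_iUnion]
  rw [h2, proj]
  simp only [h1]
  rw [psi, psi, biUnion_image]

theorem exists_isSmall (hO : IsNested cs O C) {S : Set (cutGraph cs O).ConnectedComponent}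
    (hS : S ∈ (ofTree (wallTree cs O)).sph) : ∃ R, IsSmall cs R ∧ psi cs O R = S := by
  rcases hS with ⟨P, rfl⟩ | ⟨P, Q, hPQ, rfl⟩
  · obtain ⟨a, rfl⟩ := comp_surjective P
    exact ⟨{a}, Or.inl ⟨a, rfl⟩, image_singleton⟩
  · obtain ⟨a, b, rfl, rfl, hab, -⟩ := hO.exists_panel_of_adj hPQ
    exact ⟨{a, b}, Or.inr ⟨a, b, hab, rfl⟩, image_pair _ _ _⟩

/-- Chambers of `R` in different components are separated by a wall of `C` crossing `R`. At most one
such wall exists, and its two sides give the ends of an edge. -/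
theorem psi_mem_sph (hO : IsNested cs O C) {R : Set W} (hR : R ∈ (complex cs).sph)
    (huniq : ∀ t ∈ C, ∀ t' ∈ C, Crosses cs t R → Crosses cs t' R → t = t') :
    psi cs O R ∈ (ofTree (wallTree cs O)).sph := by
  by_cases h : ∃ t ∈ C, Crosses cs t R
  · obtain ⟨t, htC, ht⟩ := h
    obtain ⟨x, hx, y, hy, hxy, rfl⟩ := exists_panel_of_crosses cs hR ht
    refine Or.inr ⟨_, _, hO.wallTree_adj hxy htC, ?_⟩
    have hcomp : ∀ a ∈ R, ∀ b ∈ R, side cs (y * x⁻¹) a = side cs (y * x⁻¹) b →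
        comp cs O a = comp cs O b := by
      intro a ha b hb hab
      rw [hO.comp_eq_iff]
      intro t' ht'
      by_contra hne
      exact hne (huniq _ htC _ ht' ht ⟨a, ha, b, hb, hne⟩ ▸ hab)
    apply Subset.antisymm
    · rintro _ ⟨a, ha, rfl⟩
      have hsep := (side_ne_iff_of_adj cs hxy _).2 rfl
      have h2 : ∀ u v w : ZMod 2, u ≠ v → w = u ∨ w = v := by decide
      rcases h2 _ _ (side cs (y * x⁻¹) a) hsep with h | h
      · exact Or.inl (hcomp a ha x hx h)
      · exact Or.inr (hcomp a ha y hy h)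
    · rintro _ (rfl | rfl)
      · exact ⟨x, hx, rfl⟩
      · exact ⟨y, hy, rfl⟩
  · obtain ⟨x, hx⟩ := sph_nonempty cs hR
    refine Or.inl ⟨comp cs O x, ?_⟩
    apply Subset.antisymm
    · rintro _ ⟨a, ha, rfl⟩
      refine hO.comp_eq_iff.2 fun t ht => ?_
      by_contra hne
      exact h ⟨t, ht, a, ha, x, hx, hne⟩
    · rintro _ rfl
      exact ⟨x, hx, rfl⟩

end IsNested

/-! ### Orbits of walls -/

/-- The reflections whose walls belong to `O`. -/
def orbitReflections (cs : CoxeterSystem M W) (O : Set (Set (Sym2 W))) : Set W :=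
  {t | cs.IsReflection t ∧ wallOf cs t ∈ O}

variable {W₀ : Subgroup W}

theorem WallOrbits.exists_reflection (O : WallOrbits cs W₀) :
    ∃ r, cs.IsReflection r ∧ O.1 = wallOrbit W₀ (wallOf cs r) := by
  obtain ⟨H, hH, hO⟩ := O.2
  obtain ⟨r, hr, rfl⟩ := (isWall_iff cs).1 hH
  exact ⟨r, hr, hO⟩

/-- With `t = g * r * g⁻¹` and `t' = h * r * h⁻¹`, the product is `g * (r * (g⁻¹ * h) * r⁻¹) * h⁻¹`,
and `W₀` is normal. -/
theorem WallOrbits.mul_mem [W₀.Normal] (O : WallOrbits cs W₀) {t t' : W}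
    (ht : t ∈ orbitReflections cs O.1) (ht' : t' ∈ orbitReflections cs O.1) : t * t' ∈ W₀ := by
  obtain ⟨r, hr, hO⟩ := O.exists_reflection
  have key : ∀ t ∈ orbitReflections cs O.1, ∃ g ∈ W₀, t = g * r * g⁻¹ := by
    rintro t ⟨ht, h⟩
    rw [hO] at h
    obtain ⟨g, hg, h⟩ := h
    rw [moveWall_wallOf] at h
    exact ⟨g, hg, wallOf_injOn cs ht h⟩
  obtain ⟨g, hg, rfl⟩ := key t ht
  obtain ⟨h, hh, rfl⟩ := key t' ht'
  have h1 : r * (g⁻¹ * h) * r⁻¹ ∈ W₀ :=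
    Subgroup.Normal.conj_mem inferInstance _ (W₀.mul_mem (inv_mem hg) hh) r
  have h2 := W₀.mul_mem (W₀.mul_mem hg h1) (inv_mem hh)
  rw [hr.inv] at h2
  convert h2 using 1
  group

theorem WallOrbits.mem_sUnion (O : WallOrbits cs W₀) {x y : W}
    (hxy : (complex cs).graph.Adj x y) :
    s(x, y) ∈ ⋃₀ O.1 ↔ y * x⁻¹ ∈ orbitReflections cs O.1 := by
  constructor
  · rintro ⟨H, hH, h⟩
    refine ⟨isReflection_of_adj cs hxy, ?_⟩
    obtain ⟨r, hr, hO⟩ := O.exists_reflection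
    rw [hO] at hH ⊢
    obtain ⟨g, hg, rfl⟩ := hH
    rw [moveWall_wallOf, mem_wallOf] at h
    exact ⟨g, hg, by rw [moveWall_wallOf, h.2]⟩
  · rintro ⟨-, h⟩
    exact ⟨_, h, (mem_wallOf cs).2 ⟨hxy, rfl⟩⟩

theorem WallOrbits.eq_of_isOfFinOrder [W₀.Normal] (torsionFree : ∀ g ∈ W₀, IsOfFinOrder g → g = 1)
    (O : WallOrbits cs W₀) {t t' : W} (ht : t ∈ orbitReflections cs O.1)
    (ht' : t' ∈ orbitReflections cs O.1) (h : IsOfFinOrder (t * t')) : t = t' := by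
  have := torsionFree _ (O.mul_mem ht ht') h
  rw [mul_eq_one_iff_eq_inv, ht'.1.inv] at this
  exact this

theorem WallOrbits.isNested [W₀.Normal] (torsionFree : ∀ g ∈ W₀, IsOfFinOrder g → g = 1)
    (O : WallOrbits cs W₀) : IsNested cs O.1 (orbitReflections cs O.1) where
  mem_sUnion _ _ h := O.mem_sUnion h
  eq_of_cross _ ht _ ht' h :=
    O.eq_of_isOfFinOrder torsionFree ht ht' (h.isOfFinOrder cs ht.1 ht'.1)

theorem WallOrbits.psi_mem_sph [W₀.Normal] (torsionFree : ∀ g ∈ W₀, IsOfFinOrder g → g = 1)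
    (O : WallOrbits cs W₀) {R : Set W} (hR : R ∈ (complex cs).sph) :
    psi cs O.1 R ∈ (treeComplex cs O).sph :=
  (O.isNested torsionFree).psi_mem_sph hR fun _ ht _ ht' h h' =>
    O.eq_of_isOfFinOrder torsionFree ht ht' (isOfFinOrder_mul_of_crosses cs hR h h')

/-- The orbit of the wall of a reflection. -/
def WallOrbits.ofReflection (W₀ : Subgroup W) {t : W} (ht : cs.IsReflection t) :
    WallOrbits cs W₀ :=
  ⟨wallOrbit W₀ (wallOf cs t), _, (isWall_iff cs).2 ⟨t, ht, rfl⟩, rfl⟩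

theorem WallOrbits.mem_ofReflection {t : W} (ht : cs.IsReflection t) :
    t ∈ orbitReflections cs (WallOrbits.ofReflection W₀ ht).1 :=
  ⟨ht, 1, one_mem _, by rw [moveWall_wallOf]; simp⟩

/-- The orbit of the wall of `w * cs.simple i * w⁻¹` depends only on `i` and the coset of `w` modulo
`W₀`. -/
theorem finite_wallOrbits [Finite B] [W₀.Normal] [W₀.FiniteIndex] : Finite (WallOrbits cs W₀) := by
  refine Finite.of_surjective (fun q : (W ⧸ W₀) × B =>
    WallOrbits.ofReflection W₀ ((cs.isReflection_simple q.2).conj q.1.out)) fun O => ?_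
  obtain ⟨r, ⟨w, i, rfl⟩, hO⟩ := O.exists_reflection
  refine ⟨(w, i), Subtype.ext ?_⟩
  rw [hO]
  obtain ⟨h, hh⟩ := QuotientGroup.mk_out_eq_mul W₀ w
  change wallOrbit W₀ (wallOf cs ((w : W ⧸ W₀).out * cs.simple i * (w : W ⧸ W₀).out⁻¹)) = _
  rw [hh]
  have hg : w * h * w⁻¹ ∈ W₀ := Subgroup.Normal.conj_mem inferInstance _ h.2 w
  have hconj : w * h * cs.simple i * (w * h)⁻¹ =
      (w * h * w⁻¹) * (w * cs.simple i * w⁻¹) * (w * h * w⁻¹)⁻¹ := by group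
  rw [hconj, ← moveWall_wallOf]
  ext K
  constructor
  · rintro ⟨g, hg', rfl⟩
    exact ⟨g * (w * h * w⁻¹), mul_mem hg' hg, (moveWall_mul _ _ _).symm⟩
  · rintro ⟨g, hg', rfl⟩
    refine ⟨g * (w * h * w⁻¹)⁻¹, mul_mem hg' (inv_mem hg), ?_⟩
    rw [← moveWall_mul, inv_mul_cancel_right]

end

end CoxeterTrees

/-! ### Geodesics in trees -/

namespace SimpleGraph

variable {V : Type*} {T : SimpleGraph V}

/-- The vertex `v` lies on a geodesic from `a` to `b`. -/
def Between (T : SimpleGraph V) (a v b : V) : Prop := T.dist a v + T.dist v b = T.dist a b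

theorem IsTree.eq_getVert_of_between (hT : T.IsTree) {a b v : V} (p : T.Walk a b) (hp : p.IsPath)
    (h : T.Between a v b) : v = p.getVert (T.dist a v) := by
  obtain ⟨q, hq⟩ := hT.connected.exists_walk_length_eq_dist a v
  obtain ⟨r, hr⟩ := hT.connected.exists_walk_length_eq_dist v b
  have hqr : (q.append r).IsPath := by
    apply Walk.isPath_of_length_eq_dist
    rw [Walk.length_append, hq, hr, h]
  rw [(hT.existsUnique_path a b).unique hp hqr, Walk.getVert_append, ← hq]
  simp

theorem IsTree.between_of_le (hT : T.IsTree) {a b v w : V} (hv : T.Between a v b)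
    (hw : T.Between a w b) (h : T.dist a v ≤ T.dist a w) : T.Between a v w := by
  obtain ⟨q, hq⟩ := hT.connected.exists_walk_length_eq_dist a w
  obtain ⟨r, hr⟩ := hT.connected.exists_walk_length_eq_dist w b
  have hqr : (q.append r).IsPath := by
    apply Walk.isPath_of_length_eq_dist
    rw [Walk.length_append, hq, hr, hw]
  have hvq : v = q.getVert (T.dist a v) := by
    have := hT.eq_getVert_of_between _ hqr hv
    rw [Walk.getVert_append] at this
    split_ifs at this with hlt
    · exact this
    · have heq : T.dist a v = q.length := by omega
      rw [heq, Nat.sub_self, Walk.getVert_zero] at this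
      rw [heq, Walk.getVert_length, this]
  have h1 : T.dist v w ≤ T.dist a w - T.dist a v := by
    have := T.dist_le (q.drop (T.dist a v))
    rwa [Walk.drop_length, hq, ← hvq] at this
  have h2 := hT.connected.dist_triangle (u := a) (v := v) (w := w)
  rw [Between]
  omega

theorem Connected.between_trans (hT : T.Connected) {a v w b : V} (h : T.Between a v w)
    (h' : T.Between a w b) : T.Between a v b := by
  have h1 := hT.dist_triangle (u := v) (v := w) (w := b)
  have h2 := hT.dist_triangle (u := a) (v := v) (w := b)
  rw [Between] at *
  omega

theorem Between.symm {a v b : V} (h : T.Between a v b) : T.Between b v a := by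
  rw [Between, dist_comm, add_comm, dist_comm, dist_comm (u := b)]
  exact h

/-- The set of vertices between two vertices of a tree is convex. -/
theorem IsTree.between_of_between (hT : T.IsTree) {a b s c d : V} (hs : T.Between a s b)
    (hc : T.Between a c b) (hd : T.Between s d c) : T.Between a d b := by
  have key : ∀ s c, T.Between a s b → T.Between a c b → T.Between s d c →
      T.dist a s ≤ T.dist a c → T.Between a d b := by
    intro s c hs hc hd hle
    have h1 := hT.between_of_le hs hc hle
    have h2 := hT.connected.dist_triangle (u := a) (v := s) (w := d)
    have h3 := hT.connected.dist_triangle (u := d) (v := c) (w := b)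
    have h4 := hT.connected.dist_triangle (u := a) (v := d) (w := b)
    rw [Between] at *
    omega
  rcases le_total (T.dist a s) (T.dist a c) with h | h
  · exact key s c hs hc hd h
  · exact key c s hc hs hd.symm h

/-- The vertices that lie in all half-trees containing `S`. -/
def hull (T : SimpleGraph V) (S : Set V) : Set V :=
  {v | ∀ c d, T.Adj c d → (∀ s ∈ S, T.dist s c < T.dist s d) → T.dist v c < T.dist v d}

/-- If `v` is off the geodesic, let `c` be its nearest point there and `c d` the first edge towards
`v`. The half-tree on the side of `c` contains `S` but not `v`. -/
theorem IsTree.between_of_mem_hull (hT : T.IsTree) {S : Set V} {a b v : V}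
    (hS : ∀ s ∈ S, T.Between a s b) (hv : v ∈ T.hull S) : T.Between a v b := by
  by_contra hnot
  have hne : {c | T.Between a c b}.Nonempty := ⟨a, by simp [Between]⟩
  set c := Function.argminOn (T.dist v) {c | T.Between a c b} hne
  have hc : T.Between a c b := Function.argminOn_mem (T.dist v) _ hne
  have hmin : ∀ s, T.Between a s b → T.dist v c ≤ T.dist v s :=
    fun s hs => Function.argminOn_le (T.dist v) {c | T.Between a c b} hs
  clear_value c
  obtain ⟨p, hp⟩ := hT.connected.exists_walk_length_eq_dist c v
  cases p with
  | nil => exact hnot hc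
  | @cons _ d _ hcd p =>
    rw [Walk.length_cons] at hp
    have hdv := T.dist_le p
    have hd : ¬ T.Between a d b := by
      intro hd
      have := hmin d hd
      rw [dist_comm, dist_comm (u := v)] at this
      omega
    have := hv c d hcd fun s hs => ?_
    · rw [dist_comm, dist_comm (u := v)] at this
      omega
    · by_contra hlt
      refine hd (hT.between_of_between (hS s hs) hc ?_)
      have h1 := hT.dist_eq_dist_add_one_of_adj s hcd
      have h2 : T.dist d c = 1 := dist_eq_one_iff_adj.2 hcd.symm
      rw [Between]
      omega

end SimpleGraph

/-! ### Segments and half-lines in trees -/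

namespace ChamberGraph

variable {V : Type*} {T : SimpleGraph V}

theorem ofTree_sph_finite {e : Set V} (he : e ∈ (ofTree T).sph) : e.Finite := by
  rcases he with ⟨a, rfl⟩ | ⟨a, b, -, rfl⟩ <;> exact toFinite _

theorem ofTree_sph_nonempty {e : Set V} (he : e ∈ (ofTree T).sph) : e.Nonempty := by
  rcases he with ⟨a, rfl⟩ | ⟨a, b, -, rfl⟩
  · exact singleton_nonempty a
  · exact insert_nonempty _ _

theorem ofTree_sph_adj {e : Set V} (he : e ∈ (ofTree T).sph) {a b : V} (ha : a ∈ e) (hb : b ∈ e) :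
    a = b ∨ T.Adj a b := by
  rcases he with ⟨c, rfl⟩ | ⟨c, d, hcd, rfl⟩
  · exact Or.inl (ha.trans hb.symm)
  · rcases ha with rfl | rfl <;> rcases hb with rfl | rfl
    · exact Or.inl rfl
    · exact Or.inr hcd
    · exact Or.inr hcd.symm
    · exact Or.inl rfl

/-- The hull of two vertices or edges of a tree lies on a geodesic. -/
theorem exists_between_of_mem_hull (hT : T.IsTree) {e f : Set V} (he : e ∈ (ofTree T).sph)
    (hf : f ∈ (ofTree T).sph) :
    ∃ a ∈ e, ∃ b ∈ f, ∀ v ∈ T.hull (e ∪ f), T.Between a v b := by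
  -- Ends at maximal distance leave all of `e` and `f` on the geodesic between them.
  obtain ⟨⟨a, b⟩, ⟨ha, hb⟩, hmax⟩ :=
    ((ofTree_sph_finite he).prod (ofTree_sph_finite hf)).exists_maximalFor (fun p : V × V => T.dist p.1 p.2) _ ((ofTree_sph_nonempty he).prod (ofTree_sph_nonempty hf))
  change a ∈ e at ha
  change b ∈ f at hb
  refine ⟨a, ha, b, hb, fun v hv => hT.between_of_mem_hull ?_ hv⟩
  rintro s (hs | hs)
  · rcases ofTree_sph_adj he ha hs with rfl | hadj
    · simp [SimpleGraph.Between]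
    · have h1 := hT.dist_eq_dist_add_one_of_adj b hadj
      have h2 : T.dist s b ≤ T.dist a b := (le_total _ _).elim id (hmax (j := (s, b)) ⟨hs, hb⟩)
      have h3 : T.dist a s = 1 := SimpleGraph.dist_eq_one_iff_adj.2 hadj
      rw [SimpleGraph.dist_comm, SimpleGraph.dist_comm (v := s)] at h1
      rw [SimpleGraph.Between]
      omega
  · rcases ofTree_sph_adj hf hb hs with rfl | hadj
    · simp [SimpleGraph.Between]
    · have h1 := hT.dist_eq_dist_add_one_of_adj a hadj
      have h2 : T.dist a s ≤ T.dist a b := (le_total _ _).elim id (hmax (j := (a, s)) ⟨ha, hs⟩)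
      have h3 : T.dist s b = 1 := SimpleGraph.dist_eq_one_iff_adj.2 hadj.symm
      rw [SimpleGraph.Between]
      omega

/-- A set of vertices of a tree that is totally ordered by betweenness from a vertex `o` lies on a
segment or on a half-line. -/
theorem exists_line_of_chain (hT : T.IsTree) (o : V) (P : Set V)
    (hP : ∀ v ∈ P, ∀ w ∈ P, T.Between o v w ∨ T.Between o w v) :
    ∃ L : Set (ofTree T).Rsph, (IsSegment T L ∨ IsHalfLine T L) ∧
      ∀ R : (ofTree T).Rsph, R.1 ⊆ P → R ∈ L := by
  have hedge : ∀ {c d : V}, T.Adj c d → ∃ c' d', ({c, d} : Set V) = {c', d'} ∧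
      T.dist o d' = T.dist o c' + 1 := by
    intro c d hcd
    rcases hT.dist_eq_dist_add_one_of_adj o hcd with h | h
    · exact ⟨d, c, pair_comm _ _, h⟩
    · exact ⟨c, d, rfl, h⟩
  by_cases hb : ∃ w ∈ P, ∀ v ∈ P, T.dist o v ≤ T.dist o w
  · obtain ⟨w, hw, hmax⟩ := hb
    have hbet : ∀ v ∈ P, T.Between o v w := by
      intro v hv
      refine (hP v hv w hw).elim id fun h => ?_
      have h1 := hmax v hv
      have h2 : T.dist w v = 0 := by
        rw [SimpleGraph.Between] at h
        omega
      rw [hT.connected.dist_eq_zero_iff.1 h2]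
      simp [SimpleGraph.Between]
    obtain ⟨p, hp, hlen⟩ := hT.connected.exists_path_of_dist o w
    refine ⟨_, Or.inl ⟨o, w, p, hp, rfl⟩, ?_⟩
    rintro ⟨R, ⟨c, rfl⟩ | ⟨c, d, hcd, rfl⟩⟩ hR
    · refine Or.inl ⟨c, ?_, rfl⟩
      rw [hT.eq_getVert_of_between p hp (hbet c (hR rfl))]
      exact p.getVert_mem_support _
    · obtain ⟨c', d', heq, hd⟩ := hedge hcd
      refine Or.inr ⟨c', d', ?_, heq⟩
      simp only [heq] at hR
      have hc' := hbet c' (hR (Or.inl rfl))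
      have hd' := hbet d' (hR (Or.inr rfl))
      have hlt : T.dist o c' < p.length := by
        rw [SimpleGraph.Between] at hd'
        omega
      have h := p.toSubgraph_adj_getVert hlt
      rw [← hd, ← hT.eq_getVert_of_between p hp hc', ← hT.eq_getVert_of_between p hp hd'] at h
      rw [← SimpleGraph.Walk.mem_edges_toSubgraph]
      exact h
  by_cases hne : P.Nonempty
  · have hunb : ∀ n, ∃ v ∈ P, n ≤ T.dist o v := by
      intro n
      induction n with
      | zero => exact ⟨_, hne.some_mem, Nat.zero_le _⟩
      | succ n ih =>
        obtain ⟨v, hv, hn⟩ := ih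
        by_contra hcon
        push Not at hcon hb
        obtain ⟨w, hw, hvw⟩ := hb v hv
        exact absurd (hcon w hw) (by omega)
    -- The vertex at distance `n` on the geodesic from `o` to a far point of `P` serves all far
    -- points, since `P` is a chain.
    have hf : ∀ n, ∃ x, T.dist o x = n ∧ ∀ w ∈ P, n ≤ T.dist o w → T.Between o x w := by
      intro n
      obtain ⟨v, hv, hn⟩ := hunb n
      obtain ⟨p, hp⟩ := hT.connected.exists_walk_length_eq_dist o v
      have h1 := T.dist_le (p.take n)
      have h2 := T.dist_le (p.drop n)
      have h3 := hT.connected.dist_triangle (u := o) (v := p.getVert n) (w := v)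
      rw [SimpleGraph.Walk.take_length] at h1
      rw [SimpleGraph.Walk.drop_length] at h2
      have hx : T.dist o (p.getVert n) = n := by omega
      have hbv : T.Between o (p.getVert n) v := by
        rw [SimpleGraph.Between]
        omega
      refine ⟨p.getVert n, hx, fun w hw hnw => ?_⟩
      rcases hP v hv w hw with h | h
      · exact hT.connected.between_trans hbv h
      · exact hT.between_of_le hbv h (by omega)
    choose f hfn hf using hf
    have hfP : ∀ v ∈ P, v = f (T.dist o v) := by
      intro v hv
      have h1 := hf (T.dist o v) v hv le_rfl
      rw [SimpleGraph.Between, hfn] at h1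
      exact (hT.connected.dist_eq_zero_iff.1 (by omega)).symm
    refine ⟨_, Or.inr ⟨f, fun m n h => ?_, fun n => ?_, rfl⟩, ?_⟩
    · rw [← hfn m, h, hfn]
    · obtain ⟨v, hv, hn⟩ := hunb (n + 1)
      have h1 := hT.between_of_le (hf n v hv (by omega)) (hf (n + 1) v hv hn)
        (by rw [hfn, hfn]; omega)
      rw [SimpleGraph.Between, hfn, hfn] at h1
      exact SimpleGraph.dist_eq_one_iff_adj.1 (by omega)
    · rintro ⟨R, ⟨c, rfl⟩ | ⟨c, d, hcd, rfl⟩⟩ hR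
      · exact Or.inl ⟨_, congrArg (fun x => ({x} : Set V)) (hfP c (hR rfl))⟩
      · obtain ⟨c', d', heq, hd⟩ := hedge hcd
        refine Or.inr ⟨T.dist o c', ?_⟩
        simp only [heq] at hR ⊢
        rw [← hd, ← hfP c' (hR (Or.inl rfl)), ← hfP d' (hR (Or.inr rfl))]
  · refine ⟨_, Or.inl ⟨o, o, .nil, .nil, rfl⟩, fun R hR => ?_⟩
    exact absurd ((ofTree_sph_nonempty R.2).mono hR) hne

/-- The vertices that lie in almost all of the hulls of `e` and the members of a sequence of
vertices and edges lie on a segment or on a half-line. -/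
theorem exists_line_of_eventually_mem_hull (hT : T.IsTree) {e : Set V} (he : e ∈ (ofTree T).sph)
    {f : ℕ → Set V} (hf : ∀ k, f k ∈ (ofTree T).sph) {P : Set V}
    (hP : ∀ v ∈ P, ∀ᶠ k in atTop, v ∈ T.hull (e ∪ f k)) :
    ∃ L : Set (ofTree T).Rsph, (IsSegment T L ∨ IsHalfLine T L) ∧
      ∀ R : (ofTree T).Rsph, R.1 ⊆ P → R ∈ L := by
  choose a ha b hb hab using fun k => exists_between_of_mem_hull hT he (hf k)
  -- As `e` is finite, some vertex is the starting point for infinitely many `k`.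
  obtain ⟨o, -, ho⟩ : ∃ o ∈ e, ∃ᶠ k in atTop, a k = o := by
    by_contra hcon
    simp only [not_exists, not_and, not_frequently] at hcon
    obtain ⟨k, hk⟩ := ((eventually_all_finite (ofTree_sph_finite he)).2 hcon).exists
    exact hk _ (ha k) rfl
  refine exists_line_of_chain hT o P fun v hv w hw => ?_
  obtain ⟨k, rfl, hvk, hwk⟩ := (ho.and_eventually ((hP v hv).and (hP w hw))).exists
  have h1 := hab k v hvk
  have h2 := hab k w hwk
  rcases le_total (T.dist (a k) v) (T.dist (a k) w) with h | h
  · exact Or.inl (hT.between_of_le h1 h2 h)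
  · exact Or.inr (hT.between_of_le h2 h1 h)

end ChamberGraph

namespace CoxeterTrees

open ChamberGraph

noncomputable section

variable {B W : Type*} [Group W] {M : CoxeterMatrix B} {cs : CoxeterSystem M W}
  {W₀ : Subgroup W}

/-! ### The map to the bordifications of the trees -/

theorem exists_isSmall_rep [W₀.Normal] (torsionFree : ∀ g ∈ W₀, IsOfFinOrder g → g = 1)
    (O : WallOrbits cs W₀) (S : (treeComplex cs O).Rsph) :
    ∃ R : (complex cs).Rsph, IsSmall cs R.1 ∧ psi cs O.1 R.1 = S.1 := by
  obtain ⟨R, hR, h⟩ := (O.isNested torsionFree).exists_isSmall S.2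
  exact ⟨⟨R, hR.mem_sph⟩, hR, h⟩

open Classical in
/-- The image of a point `ξ` of the bordification: its value on `S` is given by the value of `ξ`
on a chamber or panel whose image is `S`. -/
def phiFun (O : WallOrbits cs W₀) (ξ : (complex cs).Csph) (S : (treeComplex cs O).Rsph) :
    Set (cutGraph cs O.1).ConnectedComponent :=
  if h : ∃ R : (complex cs).Rsph, IsSmall cs R.1 ∧ psi cs O.1 R.1 = S.1 then
    psi cs O.1 (ξ.1 h.choose)
  -- This case does not occur when `W₀` is normal and torsion-free, by `exists_isSmall_rep`.
  else ∅


/-- A single residue `A` approximates `ξ` on both representatives, and `psi_proj` turns either value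
into the projection of `psi cs O.1 A.1` to `S`. -/
theorem phiFun_eq [W₀.Normal] (torsionFree : ∀ g ∈ W₀, IsOfFinOrder g → g = 1)
    (O : WallOrbits cs W₀) (ξ : (complex cs).Csph)
    (S : (treeComplex cs O).Rsph) {R : (complex cs).Rsph} (hR : IsSmall cs R.1)
    (hRS : psi cs O.1 R.1 = S.1) : phiFun O ξ S = psi cs O.1 (ξ.1 R) := by
  have h : ∃ R : (complex cs).Rsph, IsSmall cs R.1 ∧ psi cs O.1 R.1 = S.1 := ⟨R, hR, hRS⟩
  have hO := O.isNested torsionFree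
  rw [phiFun, dif_pos h]
  obtain ⟨A, hA⟩ := ξ.exists_eqOn (F := {h.choose, R}) (toFinite _)
  rw [hA _ (Or.inl rfl), hA _ (Or.inr rfl), hO.psi_proj h.choose_spec.1, hO.psi_proj hR, hRS,
    h.choose_spec.2]

theorem exists_phiFun_eqOn [W₀.Normal] (torsionFree : ∀ g ∈ W₀, IsOfFinOrder g → g = 1)
    (O : WallOrbits cs W₀) (ξ : (complex cs).Csph)
    {F : Set (treeComplex cs O).Rsph} (hF : F.Finite) :
    ∃ A : (complex cs).Rsph, ∀ S ∈ F, phiFun O ξ S =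
      (treeComplex cs O).proj S.1 (psi cs O.1 A.1) := by
  choose rep hrep hpsi using exists_isSmall_rep torsionFree O
  obtain ⟨A, hA⟩ := ξ.exists_eqOn (hF.image rep)
  refine ⟨A, fun S hS => ?_⟩
  rw [phiFun_eq torsionFree O ξ S (hrep S) (hpsi S), hA _ (mem_image_of_mem _ hS),
    (O.isNested torsionFree).psi_proj (hrep S), hpsi]

/-- The map from the bordification of the Coxeter complex to those of the trees. -/
def phi [W₀.Normal] (torsionFree : ∀ g ∈ W₀, IsOfFinOrder g → g = 1)
    (ξ : (complex cs).Csph) (O : WallOrbits cs W₀) : (treeComplex cs O).Csph :=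
  ⟨phiFun O ξ, mem_closure_of_forall_finite fun _ hF => by
    obtain ⟨A, hA⟩ := exists_phiFun_eqOn torsionFree O ξ hF
    exact ⟨⟨_, O.psi_mem_sph torsionFree A.2⟩, hA⟩⟩

/-- On a panel, use the orbit of its own wall: the two chambers then lie in different components. -/
theorem phi_injective [W₀.Normal] (torsionFree : ∀ g ∈ W₀, IsOfFinOrder g → g = 1)
    : Function.Injective (phi (cs := cs) torsionFree) := by
  intro ξ ξ' h
  refine Csph_ext cs fun x y hxy => ?_
  set R : (complex cs).Rsph := ⟨{x, y}, panel_mem_sph cs hxy⟩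
  let O := WallOrbits.ofReflection W₀ (isReflection_of_adj cs hxy)
  have hsmall : IsSmall cs R.1 := Or.inr ⟨x, y, hxy, rfl⟩
  have hmem : ∀ η : (complex cs).Csph, η.1 R ⊆ {x, y} := by
    intro η
    obtain ⟨A, hA⟩ := η.exists_eqOn (finite_singleton R)
    rw [hA R rfl]
    exact (complex cs).proj_subset _ _
  have hinj : InjOn (comp cs O.1) {x, y} := by
    have hne := ((O.isNested torsionFree).wallTree_adj hxy
      (WallOrbits.mem_ofReflection (isReflection_of_adj cs hxy))).ne
    rintro a (rfl | rfl) b (rfl | rfl) hab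
    · rfl
    · exact absurd hab hne
    · exact absurd hab.symm hne
    · rfl
  let S : (treeComplex cs O).Rsph := ⟨psi cs O.1 R.1, O.psi_mem_sph torsionFree R.2⟩
  have heq : phiFun O ξ S = phiFun O ξ' S :=
    congrFun (congrArg Subtype.val (congrFun h O)) S
  have heq' : psi cs O.1 (ξ.1 R) = psi cs O.1 (ξ'.1 R) :=
    (phiFun_eq torsionFree O ξ S hsmall rfl).symm.trans
      (heq.trans (phiFun_eq torsionFree O ξ' S hsmall rfl))
  exact (hinj.image_eq_image_iff (hmem ξ) (hmem ξ')).1 heq'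

theorem phi_ofRes [W₀.Normal] (torsionFree : ∀ g ∈ W₀, IsOfFinOrder g → g = 1)
    (R : (complex cs).Rsph) (O : WallOrbits cs W₀) :
    phi torsionFree ((complex cs).ofRes R) O =
      (treeComplex cs O).ofRes ⟨psi cs O.1 R.1, O.psi_mem_sph torsionFree R.2⟩ := by
  refine Subtype.ext (funext fun S => ?_)
  obtain ⟨A, hA, hAS⟩ := exists_isSmall_rep torsionFree O S
  change phiFun O _ S = (treeComplex cs O).proj S.1 (psi cs O.1 R.1)
  rw [phiFun_eq torsionFree O _ S hA hAS, ← hAS]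
  exact (O.isNested torsionFree).psi_proj hA R.1

theorem IsSmall.preimage {R : Set W} (hR : IsSmall cs R) (g : W) :
    IsSmall cs (graphTranslation cs g ⁻¹' R) := by
  rcases hR with ⟨a, rfl⟩ | ⟨a, b, hab, rfl⟩
  · refine Or.inl ⟨g⁻¹ * a, ?_⟩
    ext c
    exact eq_inv_mul_iff_mul_eq.symm
  · refine Or.inr ⟨g⁻¹ * a, g⁻¹ * b, (adj_mul_left cs).2 hab, ?_⟩
    ext c
    exact or_congr eq_inv_mul_iff_mul_eq.symm eq_inv_mul_iff_mul_eq.symm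

theorem image_psi (g : W) (O : Set (Set (Sym2 W))) (A : Set W) :
    treeIso cs g O '' psi cs O A = psi cs (moveWall g '' O) (graphTranslation cs g '' A) := by
  rw [psi, psi, image_image, image_image]
  rfl

/-- If `R` represents `S` for the moved orbit, its preimage under `g` represents the preimage of `S`
for `O`. -/
theorem phi_translation [W₀.Normal] (torsionFree : ∀ g ∈ W₀, IsOfFinOrder g → g = 1)
    (g : W) (ξ : (complex cs).Csph) (O : WallOrbits cs W₀) :
    phi torsionFree ((translation cs g).map ξ) (O.move cs g) =
      (isoOfTree (treeIso cs g O.1)).map (phi torsionFree ξ O) := by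
  refine Subtype.ext (funext fun S => ?_)
  obtain ⟨R, hR, hRS⟩ := exists_isSmall_rep torsionFree (O.move cs g) S
  let R' : (complex cs).Rsph := ⟨graphTranslation cs g ⁻¹' R.1, (hR.preimage g).mem_sph⟩
  have hR' : psi cs O.1 R'.1 = treeIso cs g O.1 ⁻¹' S.1 := by
    rw [← (treeIso cs g O.1).injective.preimage_image (psi cs O.1 R'.1), image_psi,
      image_preimage_eq _ (graphTranslation cs g).surjective, ← hRS]
    rfl
  refine (phiFun_eq torsionFree _ _ S hR hRS).trans (Eq.trans ?_ (congrArg (treeIso cs g O.1 '' ·)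
    (phiFun_eq torsionFree O ξ _ (hR.preimage g : IsSmall cs R'.1) hR')).symm)
  exact (image_psi g O.1 (ξ.1 R')).symm

/-! ### Sectors -/

/-- A half-tree pulls back to a root. If it contains the image of a nonempty residue, the root
contains the whole residue, hence contains it in both readings. -/
theorem IsNested.mem_hull_of_mem_conv {O : Set (Set (Sym2 W))} {C : Set W} (hO : IsNested cs O C)
    {strict : Bool} {x y : Set W} (hx : x.Nonempty) (hy : y.Nonempty) {c : W}
    (hc : c ∈ (complex cs).conv strict x y) :
    comp cs O c ∈ (wallTree cs O).hull (psi cs O x ∪ psi cs O y) := by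
  intro P Q hPQ hs
  obtain ⟨a, b, rfl, rfl, hab, hC⟩ := hO.exists_panel_of_adj hPQ
  set α : Set W := {z | side cs (b * a⁻¹) z = side cs (b * a⁻¹) a} with hα
  have hmem : ∀ z, (wallTree cs O).dist (comp cs O z) (comp cs O a) <
      (wallTree cs O).dist (comp cs O z) (comp cs O b) → z ∈ α := by
    intro z hz
    by_contra hza
    have hsep := (side_ne_iff_of_adj cs hab _).2 rfl
    have h2 : ∀ u v w : ZMod 2, u ≠ v → w ≠ u → w = v := by decide
    have hzb := h2 _ _ _ hsep hza
    rw [← adj_reflection_symm cs hab] at hzb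
    exact lt_asymm hz (hO.dist_comp_lt hab.symm (by rwa [adj_reflection_symm cs hab]) hzb)
  have hcont : ∀ {A : Set W}, A.Nonempty → A ⊆ α → Contains strict α A := by
    intro A hA hsub
    cases strict
    · obtain ⟨z, hz⟩ := hA
      exact ⟨z, hz, hsub hz⟩
    · exact hsub
  refine hO.dist_comp_lt hab hC (hc α ⟨(isRoot_iff cs).2 ⟨a, b, hab, rfl⟩, hcont hx ?_,
    hcont hy ?_⟩)
  · exact fun z hz => hmem z (hs _ (Or.inl ⟨z, hz, rfl⟩))
  · exact fun z hz => hmem z (hs _ (Or.inr ⟨z, hz, rfl⟩))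

theorem exists_line_of_isSector [W₀.Normal] (torsionFree : ∀ g ∈ W₀, IsOfFinOrder g → g = 1)
    (O : WallOrbits cs W₀) {strict : Bool} {x : (complex cs).Rsph}
    {ξ : (complex cs).Csph} {Q : Set W} (hQ : (complex cs).IsSector strict x ξ Q) :
    ∃ L : Set (treeComplex cs O).Rsph,
      (IsSegment (wallTree cs O.1) L ∨ IsHalfLine (wallTree cs O.1) L) ∧
      ∀ y : (complex cs).Rsph, y.1 ⊆ Q →
        phi torsionFree ((complex cs).ofRes y) O ∈ (treeComplex cs O).ofRes '' L := by
  obtain ⟨u, -, rfl⟩ := hQ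
  have hO := O.isNested torsionFree
  obtain ⟨L, hL, hLy⟩ := exists_line_of_eventually_mem_hull hO.isTree
    (O.psi_mem_sph torsionFree x.2) (fun k => O.psi_mem_sph torsionFree (u k).2)
    (P := psi cs O.1 (⋃ n, ⋂ k, ⋂ (_ : n ≤ k), (complex cs).conv strict x.1 (u k).1)) (by
      rintro _ ⟨c, hc, rfl⟩
      obtain ⟨n, hn⟩ := mem_iUnion.1 hc
      filter_upwards [eventually_ge_atTop n] with k hk
      exact hO.mem_hull_of_mem_conv (sph_nonempty cs x.2) (sph_nonempty cs (u k).2)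
        (mem_iInter₂.1 hn k hk))
  refine ⟨L, hL, fun y hy => ?_⟩
  rw [phi_ofRes]
  exact ⟨_, hLy ⟨_, O.psi_mem_sph torsionFree y.2⟩ (image_mono hy), rfl⟩

end

end CoxeterTrees

theorem mainTheorem4 {B W : Type*} [Finite B] [Group W] {M : CoxeterMatrix B}
    (cs : CoxeterSystem M W) (W₀ : Subgroup W) [W₀.Normal] [W₀.FiniteIndex]
    (torsionFree : ∀ g ∈ W₀, IsOfFinOrder g → g = 1) :
    Finite (CoxeterTrees.WallOrbits cs W₀) ∧
    (∀ O : CoxeterTrees.WallOrbits cs W₀, (CoxeterTrees.wallTree cs O.1).IsTree) ∧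
    ∃ φ : (CoxeterTrees.complex cs).Csph →
        ∀ O : CoxeterTrees.WallOrbits cs W₀, (CoxeterTrees.treeComplex cs O).Csph,
      Function.Injective φ ∧
      (∀ (g : W) (ξ : (CoxeterTrees.complex cs).Csph) (O : CoxeterTrees.WallOrbits cs W₀),
        φ ((CoxeterTrees.translation cs g).map ξ) (O.move cs g) =
          (ChamberGraph.isoOfTree (CoxeterTrees.treeIso cs g O.1)).map (φ ξ O)) ∧
      (∀ (R : (CoxeterTrees.complex cs).Rsph) (O : CoxeterTrees.WallOrbits cs W₀),
        ∃ h : CoxeterTrees.psi cs O.1 R.1 ∈ (CoxeterTrees.treeComplex cs O).sph,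
          φ ((CoxeterTrees.complex cs).ofRes R) O =
            (CoxeterTrees.treeComplex cs O).ofRes ⟨CoxeterTrees.psi cs O.1 R.1, h⟩) ∧
      ∀ (strict : Bool) (x : (CoxeterTrees.complex cs).Rsph) (ξ : (CoxeterTrees.complex cs).Csph)
        (Q : Set W), (CoxeterTrees.complex cs).IsSector strict x ξ Q →
        ∃ L : ∀ O : CoxeterTrees.WallOrbits cs W₀, Set (CoxeterTrees.treeComplex cs O).Rsph,
          (∀ O, ChamberGraph.IsSegment (CoxeterTrees.wallTree cs O.1) (L O) ∨
            ChamberGraph.IsHalfLine (CoxeterTrees.wallTree cs O.1) (L O)) ∧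
          ∀ y : (CoxeterTrees.complex cs).Rsph, y.1 ⊆ Q →
            ∀ O, φ ((CoxeterTrees.complex cs).ofRes y) O ∈
              (CoxeterTrees.treeComplex cs O).ofRes '' L O := by
  refine ⟨CoxeterTrees.finite_wallOrbits, fun O => (O.isNested torsionFree).isTree,
    CoxeterTrees.phi torsionFree, CoxeterTrees.phi_injective torsionFree,
    CoxeterTrees.phi_translation torsionFree,
    fun R O => ⟨O.psi_mem_sph torsionFree R.2, CoxeterTrees.phi_ofRes torsionFree R O⟩,
    fun strict x ξ Q hQ => ?_⟩
  choose L hL hy using fun O => CoxeterTrees.exists_line_of_isSector torsionFree O hQ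
  exact ⟨L, hL, fun y hyQ O => hy O y hyQ⟩
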